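/- Let $M$ be a smooth 2-dimensional manifold, $F$ a 2-form on $M$, and let $E_F=TM\oplus T^*M\oplus\mathbb R$ be the Courant algebroid of type $B_2$ with scalar product $\langle X+\xi+\lambda,Y+\eta+\mu\rangle=\frac12(\eta(X)+\xi(Y))+\lambda\mu$, anchor the projection to $TM$, and Dorfman bracket $$[X+\xi+\lambda,Y+\eta+\mu]=\mathcal L_XY+\mathcal L_X\eta-i_Yd\xi+2\mu\,d\lambda-2(\mu\, i_XF-\lambda\, i_YF)+X(\mu)-Y(\lambda)+F(X,Y).$$ A generalized metric $\mathcal G$ on $E_F$ is a rank-two subbundle $E_-\subset E_F$ on which $\langle\cdot,\cdot\rangle$ is non-degenerate and which the anchor maps isomorphically onto $TM$; put $E_+=E_-^\perp$ and $\mathcal G^{\mathrm{end}}|_{E_\pm}=\pm\mathrm{Id}$. A $B_2$-generalized almost complex structure is an endomorphism field $\mathcal F$ of $E_F$ whose $i$-eigenbundle $L\subset (E_F)_{\mathbb C}$ is isotropic of complex rank two and which vanishes on $(L\oplus\bar L)^\perp$; it is integrable if the sections of $L$ are closed under the Dorfman bracket. A $B_2$-generalized pseudo-Kähler structure is a pair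 $(\mathcal G,\mathcal F)$ with $\mathcal G^{\mathrm{end}}\mathcal F=\mathcal F\mathcal G^{\mathrm{end}}$ such that $\mathcal F$ and $\mathcal G^{\mathrm{end}}\mathcal F$ are integrable $B_2$-generalized almost complex structures. Smooth tensor fields $(g,J_+,J_-,X_+,X_-,c_+)$ on $M$ ($g$ a pseudo-Riemannian metric, $J_\pm$ endomorphism fields of $TM$, $X_\pm$ vector fields, $c_+$ a function) are called the components of $(\mathcal G,\mathcal F)$ if $E_-=\{X-i_Xg\}$ (the generalized metric is in standard form), $J_-X=\pi\mathcal F(X-i_Xg)$, $J_+X=\pi\mathcal F(X+i_Xg)$, $X_-=\pi\mathcal F(1)$ with $\pi:E_F\to TM$ the anchor, and $u_+=X_++i_{X_+}g+c_+$ satisfies $\mathcal F u_+=0$, $\langle u_+,u_+\rangle=1$. i) Let $(g,J_+,J_-,X_+,X_-,c_+)$ be the components of a $B_2$-generalized pseudo-Kähler structure on $E_F$ such that $X_+$ and $X_-$ are non-null at every point. If $M$ is connected, there is $\epsilon_0\in\{\pm1\}$ with $$J_-X_+=-\epsilon_0X_-,\quad J_-X_-=\epsilon_0X_+,\quad J_+=\epsilon_0c_+J_-.\qquad(*)$$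 If $c_+$ vanishes nowhere, then $X_+$ is a Killing field, $g(X_+,X_+)<1$ and $F=\frac1{2c_+}dX_+^\flat$. If $c_+$ vanishes identically, then $X_+$ is parallel with $g(X_+,X_+)=1$, and $F=0$. ii) Conversely, let $g$ be a pseudo-Riemannian metric on $M$, let $X_+$ be a vector field that is non-null at every point, let $X_-$ be any vector field orthogonal to $X_+$ with $g(X_-,X_-)=g(X_+,X_+)$, let $\epsilon_0,\epsilon_+\in\{\pm1\}$, and let $c_+=\epsilon_+(1-g(X_+,X_+))^{1/2}$. Assume that either $X_+$ is Killing, $g(X_+,X_+)<1$ and $F=\frac{1}{2c_+}dX_+^\flat$, or $X_+$ is parallel, $g(X_+,X_+)=1$ and $F=0$. Then there are smooth endomorphism fields $J_\pm$ satisfying $(*)$ such that $(g,J_+,J_-,X_+,X_-,c_+)$ are the components of a unique $B_2$-generalized pseudo-Kähler structure on $E_F$. iii) Let $M=G$ be a 2-dimensional Lie group with Lie algebra $\mathfrak g$. If $F$ is left-invariant and $E_F$ carries a $B_2$-generalized pseudo-Kähler structure whose components are left-invariant and have $X_\pm$ non-null, then $\mathfrak g$ is abelian (and $F=0$). -/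

import Mathlib

open scoped Manifold ContDiff Bundle TensorProduct
open VectorField

noncomputable section

namespace BGen

/-! All manifolds are smooth, modelled on `EuclideanSpace ℝ (Fin 2)` (dimension two, no boundary).
Since every `3`-form on such a manifold is zero, every `2`-form `F` is closed, satisfies
`F ∧ F = 0`, and the only possible `3`-form twist is `H = 0`. -/

section Fields

variable (M : Type*) [TopologicalSpace M] [ChartedSpace (EuclideanSpace ℝ (Fin 2)) M]

/-- Vector fields (not necessarily smooth). -/
abbrev VField : Type _ := Π x : M, TangentSpace (𝓡 2) x

/-- `1`-forms (not necessarily smooth). -/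
abbrev OneForm : Type _ := Π x : M, TangentSpace (𝓡 2) x →L[ℝ] ℝ

/-- The fibre `T_xM ⊕ T_x^*M ⊕ ℝ` at `x`. -/
abbrev Fiber (x : M) : Type _ :=
  TangentSpace (𝓡 2) x × (TangentSpace (𝓡 2) x →L[ℝ] ℝ) × ℝ

/-- Sections of `E = TM ⊕ T^*M ⊕ ℝ` (not necessarily smooth). -/
abbrev Sec : Type _ := Π x : M, Fiber M x

/-- Fields of endomorphisms of `E` (not necessarily smooth). -/
abbrev EndField : Type _ := Π x : M, Fiber M x →ₗ[ℝ] Fiber M x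

variable {M} [IsManifold (𝓡 2) ∞ M]

/-- Smooth vector fields. -/
def SmoothVField (X : VField M) : Prop :=
  ContMDiff (𝓡 2) ((𝓡 2).prod 𝓘(ℝ, EuclideanSpace ℝ (Fin 2))) ∞
    (fun x => Bundle.TotalSpace.mk' (EuclideanSpace ℝ (Fin 2)) x (X x))

/-- Smooth functions. -/
def SmoothFun (f : M → ℝ) : Prop := ContMDiff (𝓡 2) 𝓘(ℝ, ℝ) ∞ f

/-- Smooth `1`-forms, i.e. smooth sections of the cotangent bundle. -/
def SmoothOneForm (ξ : OneForm M) : Prop :=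
  ContMDiff (𝓡 2) ((𝓡 2).prod 𝓘(ℝ, EuclideanSpace ℝ (Fin 2) →L[ℝ] ℝ)) ∞
    (fun x => Bundle.TotalSpace.mk' (EuclideanSpace ℝ (Fin 2) →L[ℝ] ℝ)
      (E := fun x : M => TangentSpace (𝓡 2) x →L[ℝ] Bundle.Trivial M ℝ x) x (ξ x))

/-- Smooth fields of bilinear forms on the tangent spaces. -/
def SmoothBilin (b : Π x : M, TangentSpace (𝓡 2) x →L[ℝ] TangentSpace (𝓡 2) x →L[ℝ] ℝ) : Prop :=
  ContMDiff (𝓡 2)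
    ((𝓡 2).prod 𝓘(ℝ, EuclideanSpace ℝ (Fin 2) →L[ℝ] EuclideanSpace ℝ (Fin 2) →L[ℝ] ℝ)) ∞
    (fun x => Bundle.TotalSpace.mk' (EuclideanSpace ℝ (Fin 2) →L[ℝ] EuclideanSpace ℝ (Fin 2) →L[ℝ] ℝ)
      (E := fun x : M => TangentSpace (𝓡 2) x →L[ℝ] TangentSpace (𝓡 2) x →L[ℝ] Bundle.Trivial M ℝ x)
      x (b x))

/-- Smooth sections of `E`. -/
def SmoothSec (u : Sec M) : Prop :=
  SmoothVField (fun x => (u x).1) ∧ SmoothOneForm (fun x => (u x).2.1) ∧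
    SmoothFun (fun x => (u x).2.2)

variable (M) in
/-- (Smooth) differential `2`-forms. -/
structure TwoForm where
  toFun : Π x : M, TangentSpace (𝓡 2) x →L[ℝ] TangentSpace (𝓡 2) x →L[ℝ] ℝ
  smooth : SmoothBilin toFun
  alt : ∀ x v, toFun x v v = 0

variable (M) in
/-- (Smooth) pseudo-Riemannian metrics. -/
structure PseudoMetric where
  toFun : Π x : M, TangentSpace (𝓡 2) x →L[ℝ] TangentSpace (𝓡 2) x →L[ℝ] ℝ
  smooth : SmoothBilin toFun
  symm : ∀ x v w, toFun x v w = toFun x w v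
  nondeg : ∀ x v, (∀ w, toFun x v w = 0) → v = 0

instance : CoeFun (TwoForm M)
    (fun _ => Π x : M, TangentSpace (𝓡 2) x →L[ℝ] TangentSpace (𝓡 2) x →L[ℝ] ℝ) :=
  ⟨TwoForm.toFun⟩

instance : CoeFun (PseudoMetric M)
    (fun _ => Π x : M, TangentSpace (𝓡 2) x →L[ℝ] TangentSpace (𝓡 2) x →L[ℝ] ℝ) :=
  ⟨PseudoMetric.toFun⟩

/-- The derivative `X(f)` of a function along a vector field. -/
def dir (X : VField M) (f : M → ℝ) (x : M) : ℝ := mvfderiv (𝓡 2) f x (X x)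

/-- The exterior derivative of a `1`-form, evaluated on vector fields:
`dξ(Y, Z) = Y(ξ(Z)) - Z(ξ(Y)) - ξ([Y, Z])`. -/
def dOne (ξ : OneForm M) (Y Z : VField M) (x : M) : ℝ :=
  dir Y (fun y => ξ y (Z y)) x - dir Z (fun y => ξ y (Y y)) x - ξ x (mlieBracket (𝓡 2) Y Z x)

/-- The `1`-form `X^♭ = g(X, ·)`. -/
def flat (g : PseudoMetric M) (X : VField M) : OneForm M := fun x => g x (X x)

/-- `X` is a Killing field: `ℒ_X g = 0`. -/
def IsKilling (g : PseudoMetric M) (X : VField M) : Prop :=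
  ∀ Y Z : VField M, SmoothVField Y → SmoothVField Z → ∀ x,
    dir X (fun y => g y (Y y) (Z y)) x =
      g x (mlieBracket (𝓡 2) X Y x) (Z x) + g x (Y x) (mlieBracket (𝓡 2) X Z x)

/-- `g(∇_Y X, Z)` for the Levi-Civita connection `∇` of `g`, given by the Koszul formula. -/
def leviCivita (g : PseudoMetric M) (Y X Z : VField M) (x : M) : ℝ :=
  (1 / 2) * (dir Y (fun y => g y (X y) (Z y)) x + dir X (fun y => g y (Y y) (Z y)) x
    - dir Z (fun y => g y (Y y) (X y)) x + g x (mlieBracket (𝓡 2) Y X x) (Z x)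
    - g x (mlieBracket (𝓡 2) Y Z x) (X x) - g x (mlieBracket (𝓡 2) X Z x) (Y x))

/-- `leviCivita` agrees with every torsion-free connection compatible with `g`. -/
lemma leviCivita_eq (g : PseudoMetric M)
    (D : CovariantDerivative (𝓡 2) (EuclideanSpace ℝ (Fin 2)) (TangentSpace (𝓡 2) : M → Type _))
    (ht : D.torsion = 0)
    (hg : ∀ X Y Z : VField M, SmoothVField X → SmoothVField Y → SmoothVField Z → ∀ x,
      dir X (fun y => g y (Y y) (Z y)) x = g x (D Y x (X x)) (Z x) + g x (Y x) (D Z x (X x)))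
    (X Y Z : VField M) (hX : SmoothVField X) (hY : SmoothVField Y) (hZ : SmoothVField Z) (x : M) :
    leviCivita g Y X Z x = g x (D X x (Y x)) (Z x) := by
  have t := @fun X Y x => @(CovariantDerivative.torsion_eq_zero_iff D).1 ht X Y x
  have hX' := hX.mdifferentiable (by simp) x
  have hY' := hY.mdifferentiable (by simp) x
  have hZ' := hZ.mdifferentiable (by simp) x
  simp only [leviCivita, hg _ _ _ hX hY hZ, hg _ _ _ hY hX hZ, hg _ _ _ hZ hY hX,
    ← t _ _ _ hY' hX', ← t _ _ _ hY' hZ', ← t _ _ _ hX' hZ']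
  simp only [map_sub, sub_apply]
  rw [g.symm x (Y x), g.symm x (X x), g.symm x (Y x)]
  ring

/-- `X` is parallel for the Levi-Civita connection of `g`: `∇X = 0`, i.e. `g(∇_Y X, Z) = 0`
for all vector fields `Y`, `Z`. -/
def IsParallel (g : PseudoMetric M) (X : VField M) : Prop :=
  ∀ Y Z : VField M, SmoothVField Y → SmoothVField Z → ∀ x, leviCivita g Y X Z x = 0

end Fields

section Courant

variable {M : Type*} [TopologicalSpace M] [ChartedSpace (EuclideanSpace ℝ (Fin 2)) M]

/-- The scalar product `⟨X + ξ + λ, Y + η + μ⟩ = (η(X) + ξ(Y)) / 2 + λ μ` of `E` at `x`. -/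
def pairing (x : M) : LinearMap.BilinForm ℝ (Fiber M x) :=
  LinearMap.mk₂ ℝ (fun u v => (1 / 2) * (v.2.1 u.1 + u.2.1 v.1) + u.2.2 * v.2.2)
    (by intro u u' v; simp; ring) (by intro c u v; simp; ring)
    (by intro u v v'; simp; ring) (by intro c u v; simp; ring)

lemma pairing_isRefl (x : M) : (pairing x).IsRefl := by
  intro u v h
  simp only [pairing, LinearMap.mk₂_apply] at h ⊢
  linarith

variable [IsManifold (𝓡 2) ∞ M]

open Classical in
/-- The `1`-form defined by an operation `Φ` on vector fields which is linear over functions: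
its value `ζ` at `x` satisfies `ζ(Z(x)) = Φ(Z)(x)` for every vector field `Z`
(junk value `0` if `Φ` is not linear over functions at `x`). -/
def toOneForm (Φ : VField M → M → ℝ) : OneForm M := fun x =>
  if h : TensorialAt (𝓡 2) (EuclideanSpace ℝ (Fin 2)) (fun Z : VField M => Φ Z x) x then
    TensorialAt.mkHom (fun Z : VField M => Φ Z x) x h
  else 0

/-- The Dorfman bracket twisted by `F` (that is, by `(H, F)` with `H = 0`):
`[X + ξ + λ, Y + η + μ] = ℒ_X Y + ℒ_X η - i_Y dξ + 2 μ dλ - 2 (μ i_X F - λ i_Y F)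
  + X(μ) - Y(λ) + F(X, Y)`. -/
def dorfman (F : TwoForm M) (u v : Sec M) : Sec M :=
  let X : VField M := fun x => (u x).1
  let ξ : OneForm M := fun x => (u x).2.1
  let l : M → ℝ := fun x => (u x).2.2
  let Y : VField M := fun x => (v x).1
  let η : OneForm M := fun x => (v x).2.1
  let m : M → ℝ := fun x => (v x).2.2
  fun x =>
    (mlieBracket (𝓡 2) X Y x,
      toOneForm (fun Z y =>
        (dir X (fun z => η z (Z z)) y - η y (mlieBracket (𝓡 2) X Z y))
          - dOne ξ Y Z y + 2 * m y * dir Z l y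
          - 2 * (m y * F y (X y) (Z y) - l y * F y (Y y) (Z y))) x,
      dir X m x - dir Y l x + F x (X x) (Y x))

/-- An (admissible) generalized metric: a subbundle `E₋ ⊂ E` of rank two on which the scalar
product is nondegenerate and which the anchor maps isomorphically onto `TM`. Smoothness of `E₋`
means that the inverse `TM → E₋` of the anchor is smooth. -/
@[ext]
structure GenMetric (M : Type*) [TopologicalSpace M]
    [ChartedSpace (EuclideanSpace ℝ (Fin 2)) M] [IsManifold (𝓡 2) ∞ M] where
  Eminus : Π x : M, Submodule ℝ (Fiber M x)
  nondeg : ∀ x, ((pairing x).restrict (Eminus x)).Nondegenerate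
  admissible : ∀ x, ∀ v : TangentSpace (𝓡 2) x, ∃! u : Fiber M x, u ∈ Eminus x ∧ u.1 = v
  smooth : ∀ u : Sec M, (∀ x, u x ∈ Eminus x) → SmoothVField (fun x => (u x).1) → SmoothSec u

/-- `E₊ = E₋^⊥`. -/
def GenMetric.Eplus (G : GenMetric M) (x : M) : Submodule ℝ (Fiber M x) :=
  (pairing x).orthogonal (G.Eminus x)

lemma GenMetric.isCompl (G : GenMetric M) (x : M) : IsCompl (G.Eplus x) (G.Eminus x) := by
  have : FiniteDimensional ℝ (TangentSpace (𝓡 2) x) :=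
    inferInstanceAs (FiniteDimensional ℝ (EuclideanSpace ℝ (Fin 2)))
  have : FiniteDimensional ℝ (TangentSpace (𝓡 2) x →L[ℝ] ℝ) :=
    inferInstanceAs (FiniteDimensional ℝ (EuclideanSpace ℝ (Fin 2) →L[ℝ] ℝ))
  exact (LinearMap.BilinForm.isCompl_orthogonal_of_restrict_nondegenerate
    (pairing_isRefl x) (G.nondeg x)).symm

/-- The endomorphism `𝒢^end` with `𝒢^end = ± Id` on `E_±`. -/
def GenMetric.gend (G : GenMetric M) : EndField M := fun x =>
  (G.Eplus x).subtype ∘ₗ (G.Eplus x).projectionOnto (G.Eminus x) (G.isCompl x)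
    - (G.Eminus x).subtype ∘ₗ (G.Eminus x).projectionOnto (G.Eplus x) (G.isCompl x).symm

/-- The `ℂ`-bilinear extension of the scalar product to `E ⊗ ℂ`. -/
def pairingC (x : M) : LinearMap.BilinForm ℂ (ℂ ⊗[ℝ] Fiber M x) := (pairing x).baseChange ℂ

/-- The eigenspace, for `z ∈ ℂ`, of the complexification of an endomorphism of `E`. -/
def eigenC (A : EndField M) (z : ℂ) (x : M) : Submodule ℂ (ℂ ⊗[ℝ] Fiber M x) :=
  Module.End.eigenspace ((A x).baseChange ℂ) z

/-- `B₂`-generalized almost complex structures, given by their endomorphisms `A`: the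
`i`-eigenbundle `L` of `A` is isotropic of complex rank two (then `L̄` is the `(-i)`-eigenbundle and
`L ∩ L̄ = 0`) and `A` vanishes on the orthogonal complement of `L ⊕ L̄`. -/
structure IsBGenAlmostComplex (A : EndField M) : Prop where
  smooth : ∀ u : Sec M, SmoothSec u → SmoothSec (fun x => A x (u x))
  isotropic : ∀ x, ∀ a ∈ eigenC A Complex.I x, ∀ b ∈ eigenC A Complex.I x, pairingC x a b = 0
  rank : ∀ x, Module.finrank ℂ (eigenC A Complex.I x) = 2
  ker : ∀ x, ∀ u : Fiber M x,
    (∀ a ∈ eigenC A Complex.I x ⊔ eigenC A (-Complex.I) x, pairingC x ((1 : ℂ) ⊗ₜ[ℝ] u) a = 0) →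
      A x u = 0

/-- The section `a + i b` of `E ⊗ ℂ`. -/
def cplx (a b : Sec M) (x : M) : ℂ ⊗[ℝ] Fiber M x :=
  (1 : ℂ) ⊗ₜ[ℝ] a x + Complex.I ⊗ₜ[ℝ] b x

/-- The smooth sections of the `i`-eigenbundle of `A` are closed under the (complexified)
Dorfman bracket
`[a + i b, c + i d] = ([a, c] - [b, d]) + i ([a, d] + [b, c])`. -/
def IsIntegrable (F : TwoForm M) (A : EndField M) : Prop :=
  ∀ a b c d : Sec M, SmoothSec a → SmoothSec b → SmoothSec c → SmoothSec d →
    (∀ x, cplx a b x ∈ eigenC A Complex.I x) → (∀ x, cplx c d x ∈ eigenC A Complex.I x) →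
    ∀ x, cplx (dorfman F a c - dorfman F b d) (dorfman F a d + dorfman F b c) x
      ∈ eigenC A Complex.I x

/-- `B₂`-generalized almost pseudo-Hermitian structures `(𝒢, 𝓕)` on `E`. -/
structure IsAlmostPseudoHermitian (G : GenMetric M) (A : EndField M) : Prop where
  almostComplex : IsBGenAlmostComplex A
  commute : ∀ x, G.gend x ∘ₗ A x = A x ∘ₗ G.gend x

/-- `B₂`-generalized pseudo-Kähler structures `(𝒢, 𝓕)` on the Courant algebroid `E_F`: both `𝓕`
and `𝒢^end 𝓕` are (integrable) `B₂`-generalized complex structures. -/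
structure IsPseudoKahler (F : TwoForm M) (G : GenMetric M) (A : EndField M) : Prop where
  almostHermitian : IsAlmostPseudoHermitian G A
  integrable : IsIntegrable F A
  almostComplex_two : IsBGenAlmostComplex (fun x => G.gend x ∘ₗ A x)
  integrable_two : IsIntegrable F (fun x => G.gend x ∘ₗ A x)

/-- Data `(g, J₊, J₋, X₊, X₋, c₊)` of smooth tensor fields on `M`. -/
structure Components (M : Type*) [TopologicalSpace M]
    [ChartedSpace (EuclideanSpace ℝ (Fin 2)) M] [IsManifold (𝓡 2) ∞ M] where
  g : PseudoMetric M
  Jp : Π x : M, TangentSpace (𝓡 2) x →ₗ[ℝ] TangentSpace (𝓡 2) x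
  Jm : Π x : M, TangentSpace (𝓡 2) x →ₗ[ℝ] TangentSpace (𝓡 2) x
  Xp : VField M
  Xm : VField M
  cp : M → ℝ
  smooth_Jp : ∀ X : VField M, SmoothVField X → SmoothVField (fun x => Jp x (X x))
  smooth_Jm : ∀ X : VField M, SmoothVField X → SmoothVField (fun x => Jm x (X x))
  smooth_Xp : SmoothVField Xp
  smooth_Xm : SmoothVField Xm
  smooth_cp : SmoothFun cp

/-- `C` are the components of `(𝒢, 𝓕)`; here `𝒢` is in the standard form
`E₋ = {X - i_X g}`, `E₊ = {X + i_X g + a}`, and `J₋`, `J₊`, `X₋` are read off from the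
restrictions of `𝓕` to `E₋ ≅ TM` and `E₊ ≅ TM ⊕ ℝ`, and `X₊`, `c₊` from the section
`u₊ = X₊ + i_{X₊} g + c₊` of `Ker 𝓕` with `⟨u₊, u₊⟩ = 1`. -/
structure HasComponents (G : GenMetric M) (A : EndField M) (C : Components M) : Prop where
  standard : ∀ x, ∀ u : Fiber M x, u ∈ G.Eminus x ↔ u.2.1 = -C.g x u.1 ∧ u.2.2 = 0
  eq_Jm : ∀ x v, (A x (v, -C.g x v, 0)).1 = C.Jm x v
  eq_Jp : ∀ x v, (A x (v, C.g x v, 0)).1 = C.Jp x v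
  eq_Xm : ∀ x, (A x (0, 0, 1)).1 = C.Xm x
  uplus_ker : ∀ x, A x (C.Xp x, C.g x (C.Xp x), C.cp x) = 0
  uplus_norm : ∀ x, pairing x (C.Xp x, C.g x (C.Xp x), C.cp x)
    (C.Xp x, C.g x (C.Xp x), C.cp x) = 1

/-- `X₊` and `X₋` are non-null at every point. -/
def Components.NonNull (C : Components M) : Prop :=
  ∀ x, C.g x (C.Xp x) (C.Xp x) ≠ 0 ∧ C.g x (C.Xm x) (C.Xm x) ≠ 0

/-- `J₋X₊ = -ε₀X₋`, `J₋X₋ = ε₀X₊`, `J₊ = ε₀c₊J₋`. -/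
def Components.Relations (C : Components M) (ε₀ : ℝ) : Prop :=
  ∀ x, C.Jm x (C.Xp x) = -(ε₀ • C.Xm x) ∧ C.Jm x (C.Xm x) = ε₀ • C.Xp x ∧
    C.Jp x = (ε₀ * C.cp x) • C.Jm x

/-- `F = (1 / 2c) dX^♭`. -/
def IsHalfD (F : TwoForm M) (c : M → ℝ) (g : PseudoMetric M) (X : VField M) : Prop :=
  ∀ Y Z : VField M, SmoothVField Y → SmoothVField Z → ∀ x,
    F x (Y x) (Z x) = 1 / (2 * c x) * dOne (flat g X) Y Z x

end Courant

section Lie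

variable {G : Type*} [TopologicalSpace G] [ChartedSpace (EuclideanSpace ℝ (Fin 2)) G] [Group G]

/-- The differential at `x` of the left translation by `a`. -/
def dLeft (a x : G) : TangentSpace (𝓡 2) x →L[ℝ] TangentSpace (𝓡 2) (a * x) :=
  mfderiv (𝓡 2) (𝓡 2) (fun y => a * y) x

variable [IsManifold (𝓡 2) ∞ G]

/-- Left-invariant `2`-forms. -/
def TwoForm.LeftInvariant (F : TwoForm G) : Prop :=
  ∀ a x v w, F (a * x) (dLeft a x v) (dLeft a x w) = F x v w

/-- All of the tensor fields `(g, J₊, J₋, X₊, X₋, c₊)` are left-invariant. -/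
structure Components.LeftInvariant (C : Components G) : Prop where
  g : ∀ a x v w, C.g (a * x) (dLeft a x v) (dLeft a x w) = C.g x v w
  Jp : ∀ a x v, C.Jp (a * x) (dLeft a x v) = dLeft a x (C.Jp x v)
  Jm : ∀ a x v, C.Jm (a * x) (dLeft a x v) = dLeft a x (C.Jm x v)
  Xp : ∀ a x, C.Xp (a * x) = dLeft a x (C.Xp x)
  Xm : ∀ a x, C.Xm (a * x) = dLeft a x (C.Xm x)
  cp : ∀ a x, C.cp (a * x) = C.cp x

end Lie

end BGen

end

/-! Everything reduces to one first-order condition on `u₊`: for every section `v` of `E₋`, the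
bracket `[v, u₊]` is again a section of `E₋`.

Pointwise, an endomorphism `A` with `A u₊ = 0` and `⟨u₊, u₊⟩ = 1` satisfies the eigenspace
conditions exactly when it is skew and `A² = -1 + ⟨u₊, ·⟩ u₊` (`IsHyperplaneComplex`). Restricted to
`E₋ ≅ TM` and `E₊ ≅ TM ⊕ ℝ`, which `𝓕` preserves, these identities become `Components.Algebra`: `J₋`
is a skew complex structure, `X₊ ⊥ X₋` have the same norm `1 - c₊²`, and `J₊` is prescribed on both.
When `X₊` is non-null, `(X₊, X₋)` is a frame, `J₋` can only be a rotation by a sign, and a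
continuous sign on a connected manifold is constant.

For the differential part, `bracketPairing_plus_minus` computes `⟨[v, u₊], w⟩` and turns the
condition into `∇_Y X₊ = c₊ F(Y, ·)^♯`, `dc₊(Y) = -F(Y, X₊)` (`Components.Equations`). Integrability
of both `𝓕` and `𝒢^end 𝓕` forces it (`IsPseudoKahler.bracketPairing_uplus`). The symmetric part of
the first equation is the Killing equation, its skew part is `dX₊^♭ = 2 c₊ F`; if `c₊` is constant,
the second equation kills `F`.

Conversely, the equations suffice (`isIntegrable_of_frame`). For sections of the isotropic bundle
`L` the form `⟨[p, q], r⟩` is alternating, so it vanishes because `L` has rank two. Only `⟨[p, q],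
u₊⟩` is left, an alternating form on `L` determined by one frame pair, taken from `E₋` and `E₊`. The
second equation follows from the first and `g(X₊, X₊) + c₊² = 1` when `c₊ ≠ 0`.

On a Lie group `c₊` is constant by invariance, so `X₊` and then `X₋` are parallel; the
left-invariant frame commutes. -/

set_option linter.unusedSectionVars false

noncomputable section

namespace BGen

/-! ### Complex eigenspaces of a real endomorphism in real terms -/

section ComplexifiedLinearAlgebra

variable {V : Type*} [AddCommGroup V] [Module ℝ V]

/-- The element `a + i b` of `V ⊗ ℂ`. -/
def cpair (a b : V) : ℂ ⊗[ℝ] V := (1 : ℂ) ⊗ₜ[ℝ] a + Complex.I ⊗ₜ[ℝ] b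

/-- The map `z ⊗ v ↦ φ(z) v`. -/
def contractC (φ : ℂ →ₗ[ℝ] ℝ) : ℂ ⊗[ℝ] V →ₗ[ℝ] V :=
  (TensorProduct.lid ℝ V).toLinearMap ∘ₗ φ.rTensor V

lemma contractC_re (a b : V) : contractC Complex.reLm (cpair a b) = a := by
  simp [contractC, cpair]

lemma contractC_im (a b : V) : contractC Complex.imLm (cpair a b) = b := by
  simp [contractC, cpair]

lemma cpair_inj {a b c d : V} : cpair a b = cpair c d ↔ a = c ∧ b = d := by
  refine ⟨fun h => ⟨?_, ?_⟩, fun h => by rw [h.1, h.2]⟩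
  · rw [← contractC_re a b, h, contractC_re]
  · rw [← contractC_im a b, h, contractC_im]

lemma cpair_add (a b c d : V) : cpair a b + cpair c d = cpair (a + c) (b + d) := by
  simp only [cpair, TensorProduct.tmul_add]; abel

lemma smul_cpair (z : ℂ) (a b : V) :
    z • cpair a b = cpair (z.re • a - z.im • b) (z.re • b + z.im • a) := by
  have hz : ∀ v : V, z ⊗ₜ[ℝ] v = (1 : ℂ) ⊗ₜ[ℝ] (z.re • v) + Complex.I ⊗ₜ[ℝ] (z.im • v) := by
    intro v
    rw [← TensorProduct.smul_tmul, ← TensorProduct.smul_tmul, ← TensorProduct.add_tmul]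
    simp [Complex.re_add_im]
  have hI : z * Complex.I = z.re • Complex.I - z.im • (1 : ℂ) := by
    apply Complex.ext <;> simp
  simp only [cpair, smul_add, TensorProduct.smul_tmul', smul_eq_mul, mul_one, hI]
  simp only [hz a, TensorProduct.sub_tmul, TensorProduct.tmul_sub,
    TensorProduct.tmul_add, TensorProduct.smul_tmul]
  abel

lemma real_smul_cpair (r : ℝ) (a b : V) : r • cpair a b = cpair (r • a) (r • b) := by
  simp only [cpair, smul_add, TensorProduct.tmul_smul]

lemma exists_cpair (t : ℂ ⊗[ℝ] V) : ∃ a b : V, t = cpair a b := by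
  induction t with
  | zero => exact ⟨0, 0, by simp [cpair]⟩
  | tmul z v =>
    refine ⟨z.re • v, z.im • v, ?_⟩
    have := smul_cpair z v 0
    simpa [cpair, TensorProduct.smul_tmul'] using this
  | add s t hs ht =>
    obtain ⟨a, b, rfl⟩ := hs
    obtain ⟨c, d, rfl⟩ := ht
    exact ⟨_, _, cpair_add a b c d⟩

lemma baseChange_cpair (A : V →ₗ[ℝ] V) (a b : V) :
    A.baseChange ℂ (cpair a b) = cpair (A a) (A b) := by
  simp [cpair]

lemma cpair_mem_eigenspace_I {A : V →ₗ[ℝ] V} {a b : V} :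
    cpair a b ∈ Module.End.eigenspace (A.baseChange ℂ) Complex.I ↔ A a = -b ∧ A b = a := by
  rw [Module.End.mem_eigenspace_iff, baseChange_cpair, smul_cpair, cpair_inj]
  simp

lemma cpair_mem_eigenspace_neg_I {A : V →ₗ[ℝ] V} {a b : V} :
    cpair a b ∈ Module.End.eigenspace (A.baseChange ℂ) (-Complex.I) ↔ A a = b ∧ A b = -a := by
  rw [Module.End.mem_eigenspace_iff, baseChange_cpair, smul_cpair, cpair_inj]
  simp

lemma baseChange_form_cpair (B : LinearMap.BilinForm ℝ V) (a b c d : V) :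
    B.baseChange ℂ (cpair a b) (cpair c d) =
      ((B a c - B b d : ℝ) : ℂ) + ((B a d + B b c : ℝ) : ℂ) * Complex.I := by
  simp only [cpair, map_add, LinearMap.add_apply, LinearMap.BilinForm.baseChange_tmul]
  apply Complex.ext <;> simp [sub_eq_add_neg, add_comm]

lemma baseChange_form_cpair_eq_zero {B : LinearMap.BilinForm ℝ V} {a b c d : V} :
    B.baseChange ℂ (cpair a b) (cpair c d) = 0 ↔ B a c - B b d = 0 ∧ B a d + B b c = 0 := by
  rw [baseChange_form_cpair, Complex.ext_iff]
  simp

/-- The real subspace on which `A² = -1`. -/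
def sqNegOne (A : V →ₗ[ℝ] V) : Submodule ℝ V := LinearMap.ker (A ∘ₗ A + LinearMap.id)

lemma mem_sqNegOne {A : V →ₗ[ℝ] V} {v : V} : v ∈ sqNegOne A ↔ A (A v) = -v := by
  simp [sqNegOne, eq_neg_iff_add_eq_zero]

lemma map_mem_sqNegOne {A : V →ₗ[ℝ] V} {v : V} (h : v ∈ sqNegOne A) : A v ∈ sqNegOne A := by
  rw [mem_sqNegOne] at *
  rw [h, map_neg]

lemma cpair_sub_mem {A : V →ₗ[ℝ] V} {v : V} (h : v ∈ sqNegOne A) :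
    cpair v (-A v) ∈ Module.End.eigenspace (A.baseChange ℂ) Complex.I := by
  rw [mem_sqNegOne] at h
  rw [cpair_mem_eigenspace_I, map_neg, h]
  simp

/-- The real subspace on which `A² = -1` is isomorphic to the `i`-eigenspace. -/
def sqNegOneEquiv (A : V →ₗ[ℝ] V) :
    sqNegOne A ≃ₗ[ℝ] (Module.End.eigenspace (A.baseChange ℂ) Complex.I) :=
  LinearEquiv.ofBijective
    { toFun := fun w => ⟨cpair w.1 (-A w.1), cpair_sub_mem w.2⟩
      map_add' := fun v w => by
        apply Subtype.ext
        simp only [Submodule.coe_add, map_add, neg_add, cpair_add]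
      map_smul' := fun r v => by
        apply Subtype.ext
        simp only [Submodule.coe_smul, map_smul, RingHom.id_apply]
        erw [Submodule.coe_smul_of_tower]
        rw [real_smul_cpair, smul_neg] }
    (by
      constructor
      · intro v w h
        exact Subtype.ext (cpair_inj.1 (congrArg Subtype.val h)).1
      · rintro ⟨t, ht⟩
        obtain ⟨a, b, rfl⟩ := exists_cpair t
        have := cpair_mem_eigenspace_I.1 ht
        refine ⟨⟨a, ?_⟩, ?_⟩
        · rw [mem_sqNegOne, this.1, map_neg, this.2]
        · apply Subtype.ext
          simp [this.1])

lemma finrank_sqNegOne (A : V →ₗ[ℝ] V) :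
    Module.finrank ℝ (sqNegOne A) =
      2 * Module.finrank ℂ (Module.End.eigenspace (A.baseChange ℂ) Complex.I) := by
  rw [(sqNegOneEquiv A).finrank_eq, ← Module.finrank_mul_finrank ℝ ℂ, Complex.finrank_real_complex]

/-- A complex structure on a nondegenerate hyperplane `u^⊥`, extended by `A u = 0`. -/
structure IsHyperplaneComplex (B : LinearMap.BilinForm ℝ V) (A : V →ₗ[ℝ] V) (u : V) : Prop where
  skew : ∀ v w, B (A v) w = -B v (A w)
  sq : ∀ v, A (A v) = -v + B u v • u

/-- The real parts of `L` form the four-dimensional space `W` where `A² = -1`. Isotropy makes `A`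
skew on `W`, the kernel condition makes `W` nondegenerate, and `W^⊥` is then a line inside the
kernel of `A`, spanned by `u`. Both identities are checked on `W` and on `u`. -/
theorem isHyperplaneComplex_of_eigenspace [FiniteDimensional ℝ V] {B : LinearMap.BilinForm ℝ V} (hB : ∀ v w, B v w = B w v)
    {A : V →ₗ[ℝ] V} {u : V} (hdim : Module.finrank ℝ V = 5)
    (iso : ∀ a ∈ Module.End.eigenspace (A.baseChange ℂ) Complex.I,
      ∀ b ∈ Module.End.eigenspace (A.baseChange ℂ) Complex.I, B.baseChange ℂ a b = 0)
    (rank : Module.finrank ℂ (Module.End.eigenspace (A.baseChange ℂ) Complex.I) = 2)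
    (ker : ∀ u : V, (∀ a ∈ Module.End.eigenspace (A.baseChange ℂ) Complex.I ⊔
      Module.End.eigenspace (A.baseChange ℂ) (-Complex.I),
        B.baseChange ℂ ((1 : ℂ) ⊗ₜ[ℝ] u) a = 0) → A u = 0)
    (hAu : A u = 0) (huu : B u u = 1) : IsHyperplaneComplex B A u := by
  have hW : Module.finrank ℝ (sqNegOne A) = 4 := by rw [finrank_sqNegOne, rank]
  have skewW : ∀ v ∈ sqNegOne A, ∀ w ∈ sqNegOne A, B (A v) w = -B v (A w) := by
    intro v hv w hw
    have := (baseChange_form_cpair_eq_zero.1 (iso _ (cpair_sub_mem hv) _ (cpair_sub_mem hw))).2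
    simp only [map_neg, LinearMap.neg_apply] at this
    linarith
  -- Real and imaginary parts of vectors in `L` and `L̄` all lie in `sqNegOne A`, so orthogonality
  -- to that real space is enough.
  have ker' : ∀ v, (∀ w ∈ sqNegOne A, B v w = 0) → A v = 0 := by
    intro v hv
    apply ker
    intro a ha
    obtain ⟨p, hp, q, hq, rfl⟩ := Submodule.mem_sup.1 ha
    obtain ⟨a, b, rfl⟩ := exists_cpair p
    obtain ⟨c, d, rfl⟩ := exists_cpair q
    rw [cpair_mem_eigenspace_I] at hp
    rw [cpair_mem_eigenspace_neg_I] at hq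
    have e : (1 : ℂ) ⊗ₜ[ℝ] v = cpair v 0 := by simp [cpair]
    have h1 : a ∈ sqNegOne A := by rw [mem_sqNegOne, hp.1, map_neg, hp.2]
    have h2 : b ∈ sqNegOne A := by rw [mem_sqNegOne, hp.2, hp.1]
    have h3 : c ∈ sqNegOne A := by rw [mem_sqNegOne, hq.1, hq.2]
    have h4 : d ∈ sqNegOne A := by rw [mem_sqNegOne, hq.2, map_neg, hq.1]
    rw [cpair_add, e, baseChange_form_cpair_eq_zero]
    simp [hv _ h1, hv _ h2, hv _ h3, hv _ h4]
  have hrefl : B.IsRefl := fun v w h => by rw [hB, h]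
  -- A vector in the radical is killed by `A`, yet `A² = -1` on it, so it is zero.
  have nd : (B.restrict (sqNegOne A)).Nondegenerate := by
    have key : ∀ w : sqNegOne A, (∀ v : sqNegOne A, B w v = 0) → w = 0 := by
      rintro ⟨w, hw⟩ h
      have h0 := ker' w fun v hv => h ⟨v, hv⟩
      apply Subtype.ext
      have := mem_sqNegOne.1 hw
      rw [h0, map_zero] at this
      simpa using this.symm
    refine ⟨fun w h => key w fun v => h v, fun w h => key w fun v => ?_⟩
    rw [hB]; exact h v
  have hc := LinearMap.BilinForm.isCompl_orthogonal_of_restrict_nondegenerate hrefl nd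
  have hk : ∀ k ∈ B.orthogonal (sqNegOne A), A k = 0 := fun k hk => ker' k fun w hw => by
    rw [hB]; exact hk w hw
  -- `A` is injective on `sqNegOne A` and zero on its complement, so `A u = 0` leaves `u` no
  -- component in `sqNegOne A`.
  have huW : u ∈ B.orthogonal (sqNegOne A) := by
    intro w hw
    change B w u = 0
    have e1 := mem_sqNegOne.1 hw
    obtain ⟨w', hw', k, hk', hwk⟩ := Submodule.mem_sup.1
      (show u ∈ sqNegOne A ⊔ B.orthogonal (sqNegOne A) by rw [hc.sup_eq_top]; trivial)
    have e2 : A w' = 0 := by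
      have := congrArg A hwk
      rwa [map_add, hk k hk', add_zero, hAu] at this
    have e3 : w' = 0 := by
      have := mem_sqNegOne.1 hw'
      rw [e2, map_zero] at this
      simpa using this.symm
    rw [e3, zero_add] at hwk
    rw [← hwk]
    exact hk' w hw
  have dim1 : Module.finrank ℝ (B.orthogonal (sqNegOne A)) = 1 := by
    have := Submodule.finrank_add_eq_of_isCompl hc
    omega
  have span : ∀ k ∈ B.orthogonal (sqNegOne A), ∃ t : ℝ, t • u = k := by
    intro k hk
    have hu0 : (⟨u, huW⟩ : B.orthogonal (sqNegOne A)) ≠ 0 := by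
      intro h
      have : u = 0 := congrArg Subtype.val h
      rw [this] at huu
      simp at huu
    obtain ⟨t, ht⟩ := (finrank_eq_one_iff_of_nonzero' _ hu0).1 dim1 ⟨k, hk⟩
    exact ⟨t, congrArg Subtype.val ht⟩
  have decomp : ∀ v, ∃ w ∈ sqNegOne A, ∃ t : ℝ, v = w + t • u := by
    intro v
    obtain ⟨w, hw, k, hk, rfl⟩ := Submodule.mem_sup.1
      (show v ∈ sqNegOne A ⊔ B.orthogonal (sqNegOne A) by rw [hc.sup_eq_top]; trivial)
    obtain ⟨t, rfl⟩ := span k hk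
    exact ⟨w, hw, t, rfl⟩
  have huw : ∀ w ∈ sqNegOne A, B u w = 0 := fun w hw => by rw [hB]; exact huW w hw
  constructor
  · intro v v'
    obtain ⟨w, hw, t, rfl⟩ := decomp v
    obtain ⟨w', hw', t', rfl⟩ := decomp v'
    have h1 := huw _ (map_mem_sqNegOne hw)
    have h2 := huw _ (map_mem_sqNegOne hw')
    have h3 : B (A w) u = 0 := by rw [hB, h1]
    simp [hAu, h2, h3, skewW w hw w' hw']
  · intro v
    obtain ⟨w, hw, t, rfl⟩ := decomp v
    simp [hAu, huu, huw w hw, mem_sqNegOne.1 hw]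

namespace IsHyperplaneComplex

variable {B : LinearMap.BilinForm ℝ V} {A : V →ₗ[ℝ] V} {u : V}

lemma mem_sqNegOne_iff (h : IsHyperplaneComplex B A u) (huu : B u u = 1) {v : V} :
    v ∈ sqNegOne A ↔ B u v = 0 := by
  rw [mem_sqNegOne, h.sq]
  refine ⟨fun e => ?_, fun e => by simp [e]⟩
  have : B u v • u = 0 := by simpa using e
  have := congrArg (B u) this
  simpa [huu] using this

lemma isotropic (h : IsHyperplaneComplex B A u) :
    ∀ a ∈ Module.End.eigenspace (A.baseChange ℂ) Complex.I,
      ∀ b ∈ Module.End.eigenspace (A.baseChange ℂ) Complex.I, B.baseChange ℂ a b = 0 := by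
  intro p hp q hq
  obtain ⟨a, b, rfl⟩ := exists_cpair p
  obtain ⟨c, d, rfl⟩ := exists_cpair q
  rw [cpair_mem_eigenspace_I] at hp hq
  rw [baseChange_form_cpair_eq_zero]
  have h1 := h.skew b d
  have h2 := h.skew b c
  rw [hp.2, hq.2] at h1
  rw [hp.2, hq.1, map_neg] at h2
  constructor
  · have h3 := h.skew a d
    rw [hp.1, hq.2, map_neg, LinearMap.neg_apply] at h3
    linarith
  · linarith

/-- The space where `A² = -1` is the hyperplane `u^⊥`, of real dimension four, which is twice the
complex dimension of the eigenspace. -/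
lemma rank [FiniteDimensional ℝ V] (h : IsHyperplaneComplex B A u) (huu : B u u = 1) (hdim : Module.finrank ℝ V = 5) :
    Module.finrank ℂ (Module.End.eigenspace (A.baseChange ℂ) Complex.I) = 2 := by
  have e : sqNegOne A = LinearMap.ker (B u) := by
    ext v
    rw [h.mem_sqNegOne_iff huu, LinearMap.mem_ker]
  have h1 : Module.finrank ℝ (LinearMap.range (B u)) = 1 := by
    have : LinearMap.range (B u) = ⊤ := by
      rw [LinearMap.range_eq_top]
      intro r
      exact ⟨r • u, by simp [huu]⟩
    rw [this, finrank_top, Module.finrank_self]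
  have h2 := LinearMap.finrank_range_add_finrank_ker (B u)
  have h3 := finrank_sqNegOne A
  rw [e] at h3
  omega

/-- By skewness `B (A v) w = -B v (A w)`, and `A w` is the real part of a vector of `L`, so
nondegeneracy applies. -/
lemma eq_zero_of_orthogonal (h : IsHyperplaneComplex B A u) (hB : ∀ v w, B v w = B w v)
    (huu : B u u = 1) (hnd : ∀ v, (∀ w, B v w = 0) → v = 0) (hAu : A u = 0) (v : V)
    (hv : ∀ a ∈ Module.End.eigenspace (A.baseChange ℂ) Complex.I ⊔
      Module.End.eigenspace (A.baseChange ℂ) (-Complex.I),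
        B.baseChange ℂ ((1 : ℂ) ⊗ₜ[ℝ] v) a = 0) : A v = 0 := by
  apply hnd
  intro w
  rw [h.skew, neg_eq_zero]
  have hw : A w ∈ sqNegOne A := by
    rw [h.mem_sqNegOne_iff huu, hB, h.skew, hAu, map_zero, neg_zero]
  have := hv _ (Submodule.mem_sup_left (cpair_sub_mem hw))
  have e : (1 : ℂ) ⊗ₜ[ℝ] v = cpair v 0 := by simp [cpair]
  rw [e, baseChange_form_cpair_eq_zero] at this
  simpa using this.1

end IsHyperplaneComplex

end ComplexifiedLinearAlgebra

end BGen

end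

noncomputable section

namespace BGen

/-! ### Calculus of smooth functions, fields and sections -/

section SmoothFields

variable {M : Type*} [TopologicalSpace M] [ChartedSpace (EuclideanSpace ℝ (Fin 2)) M]
  [IsManifold (𝓡 2) ∞ M]

/-- Differentiability of a vector field at a point. -/
abbrev DiffVField (X : VField M) (x : M) : Prop :=
  MDifferentiableAt (𝓡 2) ((𝓡 2).prod 𝓘(ℝ, EuclideanSpace ℝ (Fin 2)))
    (fun x => Bundle.TotalSpace.mk' (EuclideanSpace ℝ (Fin 2)) x (X x)) x

/-- Differentiability of a function at a point. -/
abbrev DiffFun (f : M → ℝ) (x : M) : Prop := MDifferentiableAt (𝓡 2) 𝓘(ℝ, ℝ) f x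

lemma SmoothVField.diff {X : VField M} (h : SmoothVField X) (x : M) : DiffVField X x :=
  h.mdifferentiable (by simp) x

lemma SmoothFun.diff {f : M → ℝ} (h : SmoothFun f) (x : M) : DiffFun f x :=
  h.mdifferentiable (by simp) x

lemma SmoothFun.add {f h : M → ℝ} (hf : SmoothFun f) (hh : SmoothFun h) :
    SmoothFun fun x => f x + h x := ContMDiff.add hf hh

lemma SmoothFun.mul {f h : M → ℝ} (hf : SmoothFun f) (hh : SmoothFun h) :
    SmoothFun fun x => f x * h x := ContMDiff.mul hf hh

lemma SmoothFun.neg {f : M → ℝ} (hf : SmoothFun f) : SmoothFun fun x => - f x := ContMDiff.neg hf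

lemma SmoothFun.sub {f h : M → ℝ} (hf : SmoothFun f) (hh : SmoothFun h) :
    SmoothFun fun x => f x - h x := ContMDiff.sub hf hh

lemma smoothFun_const (r : ℝ) : SmoothFun fun _ : M => r := contMDiff_const

lemma SmoothFun.inv {f : M → ℝ} (hf : SmoothFun f) (h0 : ∀ x, f x ≠ 0) :
    SmoothFun fun x => (f x)⁻¹ := ContMDiff.inv₀ hf h0

lemma SmoothVField.add {X Y : VField M} (hX : SmoothVField X) (hY : SmoothVField Y) :
    SmoothVField fun x => X x + Y x := ContMDiff.add_section hX hY

lemma SmoothVField.neg {X : VField M} (hX : SmoothVField X) :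
    SmoothVField fun x => - X x := ContMDiff.neg_section hX

lemma SmoothVField.sub {X Y : VField M} (hX : SmoothVField X) (hY : SmoothVField Y) :
    SmoothVField fun x => X x - Y x := ContMDiff.sub_section hX hY

lemma SmoothVField.smul {f : M → ℝ} {X : VField M} (hf : SmoothFun f) (hX : SmoothVField X) :
    SmoothVField fun x => f x • X x := ContMDiff.smul_section hf hX

lemma smoothVField_zero : SmoothVField fun x : M => (0 : TangentSpace (𝓡 2) x) :=
  Bundle.contMDiff_zeroSection ℝ _

lemma SmoothOneForm.add {X Y : OneForm M} (hX : SmoothOneForm X) (hY : SmoothOneForm Y) :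
    SmoothOneForm fun x => X x + Y x := ContMDiff.add_section hX hY

lemma SmoothOneForm.neg {X : OneForm M} (hX : SmoothOneForm X) :
    SmoothOneForm fun x => - X x := ContMDiff.neg_section hX

lemma smoothOneForm_zero :
    SmoothOneForm fun x : M => (0 : TangentSpace (𝓡 2) x →L[ℝ] ℝ) :=
  Bundle.contMDiff_zeroSection ℝ
    (fun x : M => TangentSpace (𝓡 2) x →L[ℝ] Bundle.Trivial M ℝ x)

lemma SmoothBilin.apply {b : Π x : M, TangentSpace (𝓡 2) x →L[ℝ] TangentSpace (𝓡 2) x →L[ℝ] ℝ}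
    {X : VField M} (hb : SmoothBilin b) (hX : SmoothVField X) :
    SmoothOneForm fun x => b x (X x) :=
  ContMDiff.clm_bundle_apply (F₁ := EuclideanSpace ℝ (Fin 2))
    (F₂ := EuclideanSpace ℝ (Fin 2) →L[ℝ] ℝ) (E₁ := fun x : M => TangentSpace (𝓡 2) x)
    (E₂ := fun x : M => TangentSpace (𝓡 2) x →L[ℝ] Bundle.Trivial M ℝ x) hb hX

lemma SmoothOneForm.apply {ξ : OneForm M} {X : VField M}
    (hξ : SmoothOneForm ξ) (hX : SmoothVField X) : SmoothFun fun x => ξ x (X x) := by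
  intro x
  have := ContMDiffAt.clm_bundle_apply (F₁ := EuclideanSpace ℝ (Fin 2))
    (F₂ := ℝ) (E₁ := fun x : M => TangentSpace (𝓡 2) x)
    (E₂ := Bundle.Trivial M ℝ) (hξ x) (hX x)
  rw [Bundle.contMDiffAt_totalSpace] at this
  exact this.2

lemma SmoothOneForm.diff_apply {ξ : OneForm M} {X : VField M} {x : M}
    (hξ : SmoothOneForm ξ) (hX : DiffVField X x) : DiffFun (fun x => ξ x (X x)) x := by
  have := MDifferentiableAt.clm_bundle_apply (F₁ := EuclideanSpace ℝ (Fin 2))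
    (F₂ := ℝ) (E₁ := fun x : M => TangentSpace (𝓡 2) x)
    (E₂ := Bundle.Trivial M ℝ) ((hξ x).mdifferentiableAt (by simp)) hX
  rw [mdifferentiableAt_totalSpace] at this
  exact this.2

lemma PseudoMetric.smooth_apply (g : PseudoMetric M) {X Y : VField M} (hX : SmoothVField X)
    (hY : SmoothVField Y) : SmoothFun fun x => g x (X x) (Y x) :=
  (g.smooth.apply hX).apply hY

lemma SmoothSec.add {u v : Sec M} (hu : SmoothSec u) (hv : SmoothSec v) :
    SmoothSec fun x => u x + v x :=
  ⟨hu.1.add hv.1, hu.2.1.add hv.2.1, hu.2.2.add hv.2.2⟩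

lemma SmoothSec.neg {u : Sec M} (hu : SmoothSec u) : SmoothSec fun x => - u x :=
  ⟨hu.1.neg, hu.2.1.neg, hu.2.2.neg⟩

lemma pairing_apply (x : M) (u v : Fiber M x) :
    pairing x u v = (1 / 2) * (v.2.1 u.1 + u.2.1 v.1) + u.2.2 * v.2.2 := rfl

lemma pairing_symm (x : M) (u v : Fiber M x) : pairing x u v = pairing x v u := by
  simp only [pairing_apply]; ring

lemma dir_add (X : VField M) {f h : M → ℝ} {x : M} (hf : DiffFun f x) (hh : DiffFun h x) :
    dir X (fun y => f y + h y) x = dir X f x + dir X h x := by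
  simp only [dir, mvfderiv_fun_add hf hh, add_apply]

lemma dir_neg (X : VField M) {f : M → ℝ} {x : M} :
    dir X (fun y => - f y) x = - dir X f x := by
  simp only [dir, mvfderiv_fun_neg, neg_apply]

lemma dir_mul (X : VField M) {f h : M → ℝ} {x : M} (hf : DiffFun f x) (hh : DiffFun h x) :
    dir X (fun y => f y * h y) x = f x * dir X h x + h x * dir X f x := by
  simp only [dir, mvfderiv_fun_mul hf hh, add_apply, smul_apply,
    smul_eq_mul]

lemma dir_const (X : VField M) (r : ℝ) (x : M) : dir X (fun _ => r) x = 0 := by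
  simp only [dir, mvfderiv_const, zero_apply]

lemma dir_const_mul (X : VField M) (r : ℝ) {f : M → ℝ} {x : M} (hf : DiffFun f x) :
    dir X (fun y => r * f y) x = r * dir X f x := by
  rw [dir_mul X ((smoothFun_const r).diff x) hf, dir_const]; ring

lemma dir_smul_left (h : M → ℝ) (X : VField M) (f : M → ℝ) (x : M) :
    dir (fun y => h y • X y) f x = h x * dir X f x := by
  simp only [dir, map_smul, smul_eq_mul]

lemma dir_add_left (X Y : VField M) (f : M → ℝ) (x : M) :
    dir (fun y => X y + Y y) f x = dir X f x + dir Y f x := by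
  simp only [dir, map_add]

lemma bracket_add_right (X : VField M) {Y Z : VField M} {x : M} (hY : DiffVField Y x)
    (hZ : DiffVField Z x) :
    mlieBracket (𝓡 2) X (fun y => Y y + Z y) x =
      mlieBracket (𝓡 2) X Y x + mlieBracket (𝓡 2) X Z x :=
  mlieBracket_add_right hY hZ

lemma bracket_smul_right (X : VField M) {f : M → ℝ} {Y : VField M} {x : M} (hf : DiffFun f x)
    (hY : DiffVField Y x) :
    mlieBracket (𝓡 2) X (fun y => f y • Y y) x =
      dir X f x • Y x + f x • mlieBracket (𝓡 2) X Y x :=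
  mlieBracket_smul_right hf hY

lemma bracket_swap (X Y : VField M) (x : M) :
    mlieBracket (𝓡 2) X Y x = - mlieBracket (𝓡 2) Y X x := mlieBracket_swap_apply

end SmoothFields

/-! ### The Dorfman bracket and its invariance properties -/

section Dorfman

variable {M : Type*} [TopologicalSpace M] [ChartedSpace (EuclideanSpace ℝ (Fin 2)) M]
  [IsManifold (𝓡 2) ∞ M]

lemma TwoForm.swap (F : TwoForm M) (x : M) (v w : TangentSpace (𝓡 2) x) :
    F x v w = - F x w v := by
  have := F.alt x (v + w)
  simp only [map_add, add_apply, F.alt] at this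
  linarith

/-- The `1`-form part of `[u, v]` evaluated on `Z`. -/
def dorfmanForm (F : TwoForm M) (u v : Sec M) (Z : VField M) (x : M) : ℝ :=
  (dir (fun x => (u x).1) (fun z => (v z).2.1 (Z z)) x
    - (v x).2.1 (mlieBracket (𝓡 2) (fun x => (u x).1) Z x))
  - dOne (fun x => (u x).2.1) (fun x => (v x).1) Z x + 2 * (v x).2.2 * dir Z (fun x => (u x).2.2) x
  - 2 * ((v x).2.2 * F x (u x).1 (Z x) - (u x).2.2 * F x (v x).1 (Z x))

/-- The derivatives of a coefficient `f` of `Z` produced by the directional derivatives cancel those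
from the Lie brackets. Hence `toOneForm` does not take its default value on smooth sections. -/
lemma dorfmanForm_tensorialAt (F : TwoForm M) {u v : Sec M} (hu : SmoothSec u) (hv : SmoothSec v)
    (x : M) :
    TensorialAt (𝓡 2) (EuclideanSpace ℝ (Fin 2)) (fun Z : VField M => dorfmanForm F u v Z x) x where
  smul := by
    intro f Z hf hZ
    have e : (f • Z) = fun y => f y • Z y := rfl
    simp only [dorfmanForm, dOne, e, map_smul, smul_eq_mul]
    rw [dir_mul _ hf (hv.2.1.diff_apply hZ), dir_mul _ hf (hu.2.1.diff_apply hZ),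
      bracket_smul_right _ hf hZ, bracket_smul_right _ hf hZ]
    simp only [map_add, map_smul, smul_eq_mul, dir_smul_left]
    ring
  add := by
    intro Y Z hY hZ
    have e : (Y + Z) = fun y => Y y + Z y := rfl
    simp only [dorfmanForm, dOne, e, map_add]
    rw [dir_add _ (hv.2.1.diff_apply hY) (hv.2.1.diff_apply hZ),
      dir_add _ (hu.2.1.diff_apply hY) (hu.2.1.diff_apply hZ),
      bracket_add_right _ hY hZ, bracket_add_right _ hY hZ]
    simp only [map_add, dir_add_left]
    ring

lemma dorfman_fst (F : TwoForm M) (u v : Sec M) (x : M) :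
    (dorfman F u v x).1 = mlieBracket (𝓡 2) (fun x => (u x).1) (fun x => (v x).1) x := rfl

lemma dorfman_scalar (F : TwoForm M) (u v : Sec M) (x : M) :
    (dorfman F u v x).2.2 = dir (fun x => (u x).1) (fun x => (v x).2.2) x
      - dir (fun x => (v x).1) (fun x => (u x).2.2) x + F x (u x).1 (v x).1 := rfl

lemma dorfman_form (F : TwoForm M) {u v : Sec M} (hu : SmoothSec u) (hv : SmoothSec v)
    {Z : VField M} {x : M} (hZ : DiffVField Z x) :
    (dorfman F u v x).2.1 (Z x) = dorfmanForm F u v Z x := by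
  have h := dorfmanForm_tensorialAt F hu hv x
  change toOneForm (dorfmanForm F u v) x (Z x) = _
  rw [toOneForm, dif_pos h]
  exact TensorialAt.mkHom_apply h hZ

/-- `⟨[p, q], r⟩`. -/
def bracketPairing (F : TwoForm M) (p q r : Sec M) (x : M) : ℝ :=
  pairing x (dorfman F p q x) (r x)

lemma bracketPairing_eq (F : TwoForm M) {p q r : Sec M} (hp : SmoothSec p) (hq : SmoothSec q)
    (hr : SmoothSec r) (x : M) :
    bracketPairing F p q r x = (1 / 2) *
      ((r x).2.1 (mlieBracket (𝓡 2) (fun x => (p x).1) (fun x => (q x).1) x)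
        + dorfmanForm F p q (fun x => (r x).1) x)
      + (dir (fun x => (p x).1) (fun x => (q x).2.2) x
      - dir (fun x => (q x).1) (fun x => (p x).2.2) x + F x (p x).1 (q x).1) * (r x).2.2 := by
  rw [bracketPairing, pairing_apply, dorfman_form F hp hq (hr.1.diff x), dorfman_fst,
    dorfman_scalar]

/-- The Courant algebroid axiom that the bracket acts by derivations on the scalar product. -/
lemma bracketPairing_compat (F : TwoForm M) {p q r : Sec M} (hp : SmoothSec p) (hq : SmoothSec q)
    (hr : SmoothSec r) (x : M) :
    bracketPairing F p q r x + bracketPairing F p r q x =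
      dir (fun x => (p x).1) (fun x => pairing x (q x) (r x)) x := by
  rw [bracketPairing_eq F hp hq hr, bracketPairing_eq F hp hr hq]
  simp only [pairing_apply]
  have a1 := (hr.2.1.apply hq.1)
  have a2 := (hq.2.1.apply hr.1)
  rw [dir_add _ (((smoothFun_const _).mul (a1.add a2)).diff x) ((hq.2.2.mul hr.2.2).diff x),
    dir_const_mul _ _ ((a1.add a2).diff x), dir_add _ (a1.diff x) (a2.diff x),
    dir_mul _ (hq.2.2.diff x) (hr.2.2.diff x)]
  simp only [dorfmanForm, dOne]
  rw [bracket_swap (fun x => (r x).1) (fun x => (q x).1), map_neg, F.swap x (r x).1 (q x).1]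
  ring

/-- The Courant algebroid axiom that the symmetric part of the bracket is the differential of the
scalar product. -/
lemma bracketPairing_swap (F : TwoForm M) {p q r : Sec M} (hp : SmoothSec p) (hq : SmoothSec q)
    (hr : SmoothSec r) (x : M) :
    bracketPairing F p q r x + bracketPairing F q p r x =
      dir (fun x => (r x).1) (fun x => pairing x (p x) (q x)) x := by
  rw [bracketPairing_eq F hp hq hr, bracketPairing_eq F hq hp hr]
  simp only [pairing_apply]
  have a1 := (hq.2.1.apply hp.1)
  have a2 := (hp.2.1.apply hq.1)
  rw [dir_add _ (((smoothFun_const _).mul (a1.add a2)).diff x) ((hp.2.2.mul hq.2.2).diff x),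
    dir_const_mul _ _ ((a1.add a2).diff x), dir_add _ (a1.diff x) (a2.diff x),
    dir_mul _ (hp.2.2.diff x) (hq.2.2.diff x)]
  simp only [dorfmanForm, dOne]
  rw [bracket_swap (fun x => (q x).1) (fun x => (p x).1), map_neg, F.swap x (q x).1 (p x).1]
  ring

end Dorfman

/-! ### The Koszul expression and its relation to the bracket -/

section LeviCivita

variable {M : Type*} [TopologicalSpace M] [ChartedSpace (EuclideanSpace ℝ (Fin 2)) M]
  [IsManifold (𝓡 2) ∞ M]

lemma leviCivita_compat (g : PseudoMetric M) (Y X Z : VField M) (x : M) :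
    leviCivita g Y X Z x + leviCivita g Y Z X x = dir Y (fun y => g y (X y) (Z y)) x := by
  have e : (fun y => g y (Z y) (X y)) = fun y => g y (X y) (Z y) := funext fun y => g.symm y _ _
  have e1 := g.symm x (Y x) (mlieBracket (𝓡 2) X Z x)
  simp only [leviCivita, e]
  rw [bracket_swap Z X, map_neg, neg_apply]
  ring

lemma leviCivita_torsion (g : PseudoMetric M) (X Y Z : VField M) (x : M) :
    leviCivita g X Y Z x - leviCivita g Y X Z x = g x (mlieBracket (𝓡 2) X Y x) (Z x) := by
  have e : (fun y => g y (Y y) (X y)) = fun y => g y (X y) (Y y) := funext fun y => g.symm y _ _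
  simp only [leviCivita, e]
  rw [bracket_swap Y X, map_neg, neg_apply]
  ring

/-- The symmetric part of `∇X` is governed by `ℒ_X g`; it vanishes exactly for Killing fields. -/
lemma leviCivita_symm_eq (g : PseudoMetric M) (X Y Z : VField M) (x : M) :
    leviCivita g Y X Z x + leviCivita g Z X Y x = dir X (fun y => g y (Y y) (Z y)) x -
      (g x (mlieBracket (𝓡 2) X Y x) (Z x) + g x (Y x) (mlieBracket (𝓡 2) X Z x)) := by
  have e1 : ∀ X Y : VField M, (fun y => g y (Y y) (X y)) = fun y => g y (X y) (Y y) :=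
    fun X Y => funext fun y => g.symm y _ _
  simp only [leviCivita, e1 X Y, e1 Z X, e1 Y Z]
  rw [bracket_swap Y X, bracket_swap Z X, bracket_swap Z Y, g.symm x (Y x)]
  simp only [map_neg, neg_apply]
  ring

/-- The skew part of `∇X` is governed by `dX^♭`, because the connection is torsion-free. -/
lemma leviCivita_skew_eq (g : PseudoMetric M) (X Y Z : VField M) (x : M) :
    leviCivita g Y X Z x - leviCivita g Z X Y x = dOne (flat g X) Y Z x := by
  have e1 : ∀ X Y : VField M, (fun y => g y (Y y) (X y)) = fun y => g y (X y) (Y y) :=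
    fun X Y => funext fun y => g.symm y _ _
  simp only [leviCivita, dOne, flat, e1 X Y, e1 X Z, e1 Y Z]
  rw [bracket_swap Y X, bracket_swap Z X, bracket_swap Z Y, g.symm x (X x)]
  simp only [map_neg, neg_apply]
  ring

/-- The bracket of a section of `E₊` with a section of `E₋`, paired with a section of `E₊`. -/
lemma bracketPairing_plus_minus (F : TwoForm M) (g : PseudoMetric M) {W X Y : VField M}
    {l c : M → ℝ} (hW : SmoothVField W) (hX : SmoothVField X) (hY : SmoothVField Y)
    (hl : SmoothFun l) (hc : SmoothFun c) (x : M) :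
    bracketPairing F (fun x => (Y x, -g x (Y x), 0)) (fun x => (X x, g x (X x), c x))
      (fun x => (W x, g x (W x), l x)) x =
      leviCivita g Y X W x - c x * F x (Y x) (W x) + l x * (dir Y c x + F x (Y x) (X x)) := by
  have hu : SmoothSec (fun x => (X x, g x (X x), c x)) := ⟨hX, g.smooth.apply hX, hc⟩
  have hw : SmoothSec (fun x => (W x, g x (W x), l x)) := ⟨hW, g.smooth.apply hW, hl⟩
  have hv : SmoothSec (fun x => (Y x, -g x (Y x), 0)) :=
    ⟨hY, (g.smooth.apply hY).neg, smoothFun_const 0⟩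
  rw [bracketPairing_eq F hv hu hw]
  simp only [dorfmanForm, dOne, leviCivita, dir_const, neg_apply]
  rw [dir_neg, dir_neg, g.symm x (W x), g.symm x (X x), g.symm x (Y x)]
  ring

end LeviCivita

end BGen

end

noncomputable section

namespace BGen

/-! ### Pointwise algebra of the splitting into `E₋` and `E₊` -/

section Pointwise

variable {M : Type*} [TopologicalSpace M] [ChartedSpace (EuclideanSpace ℝ (Fin 2)) M]
  [IsManifold (𝓡 2) ∞ M]

instance finiteDimensional_tangentSpace (x : M) :
    FiniteDimensional ℝ (TangentSpace (𝓡 2) x) :=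
  inferInstanceAs (FiniteDimensional ℝ (EuclideanSpace ℝ (Fin 2)))

instance finiteDimensional_cotangentSpace (x : M) :
    FiniteDimensional ℝ (TangentSpace (𝓡 2) x →L[ℝ] ℝ) :=
  inferInstanceAs (FiniteDimensional ℝ (EuclideanSpace ℝ (Fin 2) →L[ℝ] ℝ))

lemma finrank_tangentSpace (x : M) : Module.finrank ℝ (TangentSpace (𝓡 2) x) = 2 :=
  (finrank_euclideanSpace_fin : Module.finrank ℝ (EuclideanSpace ℝ (Fin 2)) = 2)

lemma finrank_cotangentSpace (x : M) :
    Module.finrank ℝ (TangentSpace (𝓡 2) x →L[ℝ] ℝ) = 2 := by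
  have e : Module.finrank ℝ (EuclideanSpace ℝ (Fin 2) →L[ℝ] ℝ) = 2 := by
    rw [← (LinearMap.toContinuousLinearMap (𝕜 := ℝ) (E := EuclideanSpace ℝ (Fin 2))
      (F' := ℝ)).finrank_eq, Module.finrank_linearMap, Module.finrank_self,
      finrank_euclideanSpace_fin]
  exact e

lemma finrank_fiber (x : M) : Module.finrank ℝ (Fiber M x) = 5 := by
  rw [Module.finrank_prod, Module.finrank_prod, finrank_tangentSpace, finrank_cotangentSpace,
    Module.finrank_self]

lemma PseudoMetric.exists_apply_eq (g : PseudoMetric M) (x : M)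
    (ξ : TangentSpace (𝓡 2) x →L[ℝ] ℝ) : ∃ v, g x v = ξ := by
  have inj : Function.Injective (g x).toLinearMap := by
    rw [← LinearMap.ker_eq_bot, LinearMap.ker_eq_bot']
    intro v hv
    exact g.nondeg x v fun w => DFunLike.congr_fun hv w
  exact (LinearMap.injective_iff_surjective_of_finrank_eq_finrank
    (by rw [finrank_tangentSpace, finrank_cotangentSpace])).1 inj ξ

/-- The element `v - i_v g` of `E₋`. -/
def minus (g : PseudoMetric M) (x : M) (v : TangentSpace (𝓡 2) x) : Fiber M x := (v, -g x v, 0)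

/-- The element `v + i_v g + l` of `E₊`. -/
def plus (g : PseudoMetric M) (x : M) (v : TangentSpace (𝓡 2) x) (l : ℝ) : Fiber M x :=
  (v, g x v, l)

section

variable (g : PseudoMetric M) (x : M)

lemma pairing_minus_minus (v w : TangentSpace (𝓡 2) x) :
    pairing x (minus g x v) (minus g x w) = -g x v w := by
  simp only [pairing_apply, minus, neg_apply, g.symm x w v]; ring

lemma pairing_plus_plus (v w : TangentSpace (𝓡 2) x) (l m : ℝ) :
    pairing x (plus g x v l) (plus g x w m) = g x v w + l * m := by
  simp only [pairing_apply, plus, g.symm x w v]; ring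

lemma pairing_minus_plus (v w : TangentSpace (𝓡 2) x) (l : ℝ) :
    pairing x (minus g x v) (plus g x w l) = 0 := by
  simp only [pairing_apply, minus, plus, neg_apply, g.symm x w v]; ring

lemma pairing_plus_minus (v w : TangentSpace (𝓡 2) x) (l : ℝ) :
    pairing x (plus g x w l) (minus g x v) = 0 := by
  rw [pairing_symm, pairing_minus_plus]

lemma minus_add (v w : TangentSpace (𝓡 2) x) :
    minus g x (v + w) = minus g x v + minus g x w := by
  simp [minus, add_comm]

lemma minus_smul (r : ℝ) (v : TangentSpace (𝓡 2) x) :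
    minus g x (r • v) = r • minus g x v := by
  simp [minus]

lemma minus_neg (v : TangentSpace (𝓡 2) x) : minus g x (-v) = -minus g x v := by
  simp [minus]

lemma plus_add (v w : TangentSpace (𝓡 2) x) (l m : ℝ) :
    plus g x (v + w) (l + m) = plus g x v l + plus g x w m := by
  simp [plus]

lemma plus_smul (r l : ℝ) (v : TangentSpace (𝓡 2) x) :
    plus g x (r • v) (r * l) = r • plus g x v l := by
  simp [plus]

lemma plus_neg (l : ℝ) (v : TangentSpace (𝓡 2) x) :
    plus g x (-v) (-l) = -plus g x v l := by
  simp [plus]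

lemma minus_inj {v w : TangentSpace (𝓡 2) x} : minus g x v = minus g x w ↔ v = w :=
  ⟨fun h => congrArg Prod.fst h, fun h => by rw [h]⟩

lemma plus_inj {v w : TangentSpace (𝓡 2) x} {l m : ℝ} :
    plus g x v l = plus g x w m ↔ v = w ∧ l = m :=
  ⟨fun h => ⟨congrArg Prod.fst h, congrArg (fun p => p.2.2) h⟩, fun h => by rw [h.1, h.2]⟩

lemma exists_minus_add_plus (u : Fiber M x) :
    ∃ v w l, u = minus g x v + plus g x w l := by
  obtain ⟨s, hs⟩ := g.exists_apply_eq x u.2.1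
  -- With `g(s, ·)` the form part of `u`, the witnesses solve `v + w = u.1` and `w - v = s`.
  refine ⟨(1 / 2 : ℝ) • (u.1 - s), (1 / 2 : ℝ) • (u.1 + s), u.2.2, ?_⟩
  refine Prod.ext ?_ (Prod.ext ?_ ?_)
  · simp only [minus, plus, Prod.fst_add]
    module
  · simp only [minus, plus, Prod.fst_add, Prod.snd_add, map_smul, map_sub, map_add, hs]
    module
  · simp [minus, plus]

include g in
lemma pairing_nondegenerate (u : Fiber M x) (h : ∀ w, pairing x u w = 0) : u = 0 := by
  obtain ⟨v, w, l, rfl⟩ := exists_minus_add_plus g x u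
  have h1 : v = 0 := g.nondeg x v fun v' => by
    have := h (minus g x v')
    rw [map_add, LinearMap.add_apply, pairing_minus_minus, pairing_plus_minus] at this
    linarith
  have h2 : w = 0 := g.nondeg x w fun v' => by
    have := h (plus g x v' 0)
    rw [map_add, LinearMap.add_apply, pairing_minus_plus, pairing_plus_plus] at this
    linarith
  have h3 : l = 0 := by
    have := h (plus g x 0 1)
    rw [map_add, LinearMap.add_apply, pairing_minus_plus, pairing_plus_plus, map_zero] at this
    linarith
  simp [h1, h2, h3, minus, plus]

/-- A pair of orthogonal vectors of the same nonzero norm gives a frame. -/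
lemma PseudoMetric.frame_expand {a b : TangentSpace (𝓡 2) x} {N : ℝ} (hN : N ≠ 0)
    (haa : g x a a = N) (hbb : g x b b = N) (hab : g x a b = 0) (v : TangentSpace (𝓡 2) x) :
    v = (N⁻¹ * g x v a) • a + (N⁻¹ * g x v b) • b := by
  have hba : g x b a = 0 := by rw [g.symm, hab]
  have li : LinearIndependent ℝ ![a, b] := by
    rw [LinearIndependent.pair_iff]
    intro s t h
    have h1 := congrArg (fun w => g x w a) h
    have h2 := congrArg (fun w => g x w b) h
    simp [haa, hab, hbb, hba, hN] at h1 h2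
    exact ⟨h1, h2⟩
  have sp := li.span_eq_top_of_card_eq_finrank (by rw [finrank_tangentSpace]; simp)
  obtain ⟨s, t, rfl⟩ := Submodule.mem_span_pair.1
    (show v ∈ Submodule.span ℝ {a, b} by
      have : v ∈ Submodule.span ℝ (Set.range ![a, b]) := by rw [sp]; trivial
      rwa [Matrix.range_cons_cons_empty] at this)
  simp [haa, hab, hbb, hba]
  field_simp

end

section GenMetric

variable {G : GenMetric M} {g : PseudoMetric M} {x : M}

/-- The subbundle `E₋` is `{v - i_v g}`. -/
def IsStandard (G : GenMetric M) (g : PseudoMetric M) : Prop :=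
  ∀ x, ∀ u : Fiber M x, u ∈ G.Eminus x ↔ u.2.1 = -g x u.1 ∧ u.2.2 = 0

lemma IsStandard.minus_mem (h : IsStandard G g) (v : TangentSpace (𝓡 2) x) :
    minus g x v ∈ G.Eminus x := (h x _).2 ⟨rfl, rfl⟩

lemma IsStandard.eq_minus (h : IsStandard G g) {u : Fiber M x} (hu : u ∈ G.Eminus x) :
    u = minus g x u.1 := by
  obtain ⟨h1, h2⟩ := (h x u).1 hu
  exact Prod.ext rfl (Prod.ext h1 h2)

lemma IsStandard.plus_mem (h : IsStandard G g) (v : TangentSpace (𝓡 2) x) (l : ℝ) :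
    plus g x v l ∈ G.Eplus x := by
  intro u hu
  rw [h.eq_minus hu]
  exact pairing_minus_plus g x _ _ _

lemma IsStandard.gend_minus (h : IsStandard G g) (v : TangentSpace (𝓡 2) x) :
    G.gend x (minus g x v) = -minus g x v := by
  simp only [GenMetric.gend, LinearMap.sub_apply, LinearMap.comp_apply]
  rw [(Submodule.projectionOnto_apply_eq_zero_iff _).2 (h.minus_mem v),
    Submodule.projectionOnto_apply_of_mem_left _ (h.minus_mem v)]
  simp

lemma IsStandard.gend_plus (h : IsStandard G g) (v : TangentSpace (𝓡 2) x) (l : ℝ) :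
    G.gend x (plus g x v l) = plus g x v l := by
  simp only [GenMetric.gend, LinearMap.sub_apply, LinearMap.comp_apply]
  rw [(Submodule.projectionOnto_apply_eq_zero_iff (G.isCompl x).symm).2 (h.plus_mem v l),
    Submodule.projectionOnto_apply_of_mem_left _ (h.plus_mem v l)]
  simp

lemma IsStandard.eq_minus_of_gend (h : IsStandard G g) {u : Fiber M x} (hu : G.gend x u = -u) :
    u = minus g x u.1 := by
  obtain ⟨v, w, l, rfl⟩ := exists_minus_add_plus g x u
  rw [map_add, h.gend_minus, h.gend_plus] at hu
  have e : (2 : ℝ) • plus g x w l = 0 := by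
    rw [two_smul]
    have := congrArg (fun z => z + minus g x v + plus g x w l) hu
    simpa using this
  have e2 : plus g x w l = 0 := by simpa using e
  rw [e2]; simp [minus]

lemma IsStandard.eq_plus_of_gend (h : IsStandard G g) {u : Fiber M x} (hu : G.gend x u = u) :
    u = plus g x u.1 u.2.2 := by
  obtain ⟨v, w, l, rfl⟩ := exists_minus_add_plus g x u
  rw [map_add, h.gend_minus, h.gend_plus] at hu
  have e : (2 : ℝ) • minus g x v = 0 := by
    rw [two_smul]
    have := add_right_cancel hu
    nth_rewrite 1 [← this]
    exact neg_add_cancel _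
  have e2 : minus g x v = 0 := by simpa using e
  rw [e2]; simp [plus]

end GenMetric

section Structure

variable {G : GenMetric M} {A : EndField M} {C : Components M}

/-- The vector `u₊ = X₊ + i_{X₊} g + c₊`. -/
def Components.uplus (C : Components M) : Sec M := fun x => plus C.g x (C.Xp x) (C.cp x)

lemma Components.smooth_uplus (C : Components M) : SmoothSec C.uplus :=
  ⟨C.smooth_Xp, C.g.smooth.apply C.smooth_Xp, C.smooth_cp⟩

lemma HasComponents.isStandard (hC : HasComponents G A C) : IsStandard G C.g := hC.standard

lemma HasComponents.isHyperplaneComplex (hA : IsAlmostPseudoHermitian G A)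
    (hC : HasComponents G A C) (x : M) :
    IsHyperplaneComplex (pairing x) (A x) (C.uplus x) :=
  isHyperplaneComplex_of_eigenspace (pairing_symm x) (finrank_fiber x)
    (hA.almostComplex.isotropic x) (hA.almostComplex.rank x) (hA.almostComplex.ker x)
    (hC.uplus_ker x) (hC.uplus_norm x)

lemma HasComponents.apply_minus (hA : IsAlmostPseudoHermitian G A) (hC : HasComponents G A C)
    (x : M) (v : TangentSpace (𝓡 2) x) : A x (minus C.g x v) = minus C.g x (C.Jm x v) := by
  have e := DFunLike.congr_fun (hA.commute x) (minus C.g x v)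
  simp only [LinearMap.comp_apply, hC.isStandard.gend_minus, map_neg] at e
  rw [hC.isStandard.eq_minus_of_gend e, minus_inj]
  exact hC.eq_Jm x v

/-- Commuting with `𝒢^end` keeps `E₊` invariant, so only the vector and scalar parts matter. The
vector part is given by the components; the scalar part is recovered by pairing with the section `1`
and using skewness. -/
lemma HasComponents.apply_plus (hA : IsAlmostPseudoHermitian G A) (hC : HasComponents G A C)
    (x : M) (v : TangentSpace (𝓡 2) x) (l : ℝ) :
    A x (plus C.g x v l) =
      plus C.g x (C.Jp x v + l • C.Xm x) (-C.g x v (C.Xm x)) := by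
  have key : ∀ v l, A x (plus C.g x v l) =
      plus C.g x (A x (plus C.g x v l)).1 (A x (plus C.g x v l)).2.2 := by
    intro v l
    have e := DFunLike.congr_fun (hA.commute x) (plus C.g x v l)
    simp only [LinearMap.comp_apply, hC.isStandard.gend_plus] at e
    exact hC.isStandard.eq_plus_of_gend e
  have h1 : (A x (plus C.g x 0 1)).1 = C.Xm x := by
    have := hC.eq_Xm x
    rw [← this]; simp [plus]
  have h2 : (A x (plus C.g x v l)).1 = C.Jp x v + l • C.Xm x := by
    have : plus C.g x v l = plus C.g x v 0 + l • plus C.g x 0 1 := by simp [plus]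
    rw [this, map_add, map_smul, Prod.fst_add, Prod.smul_fst, h1]
    exact congrArg (· + _) (hC.eq_Jp x v)
  have skew := (hC.isHyperplaneComplex hA x).skew
  have h3 : (A x (plus C.g x 0 1)).2.2 = 0 := by
    have := skew (plus C.g x 0 1) (plus C.g x 0 1)
    rw [key 0 1, pairing_plus_plus, pairing_plus_plus, h1] at this
    simp only [map_zero, zero_apply] at this
    linarith
  have h4 : (A x (plus C.g x v l)).2.2 = -C.g x v (C.Xm x) := by
    have := skew (plus C.g x v l) (plus C.g x 0 1)
    rw [key v l, key 0 1, pairing_plus_plus, pairing_plus_plus, h1, h3] at this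
    simp only [map_zero] at this
    linarith
  rw [key, h2, h4]

/-- The pointwise algebraic identities satisfied by the components. -/
structure Components.Algebra (C : Components M) (x : M) : Prop where
  norm : C.g x (C.Xp x) (C.Xp x) + C.cp x * C.cp x = 1
  norm_Xm : C.g x (C.Xm x) (C.Xm x) = C.g x (C.Xp x) (C.Xp x)
  orth : C.g x (C.Xp x) (C.Xm x) = 0
  Jm_sq : ∀ v, C.Jm x (C.Jm x v) = -v
  Jm_skew : ∀ v w, C.g x (C.Jm x v) w = -C.g x v (C.Jm x w)
  Jp_Xp : C.Jp x (C.Xp x) = -(C.cp x • C.Xm x)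
  Jp_Xm : C.Jp x (C.Xm x) = C.cp x • C.Xp x

/-- The identities are `𝓕 u₊ = 0`, the formula for `𝓕²` evaluated at the section `1`, and skewness
and `𝓕² = -1` on `E₋`. -/
lemma HasComponents.algebra (hA : IsAlmostPseudoHermitian G A) (hC : HasComponents G A C)
    (x : M) : C.Algebra x := by
  have hc := hC.isHyperplaneComplex hA x
  have norm : C.g x (C.Xp x) (C.Xp x) + C.cp x * C.cp x = 1 := by
    rw [← pairing_plus_plus]; exact hC.uplus_norm x
  have ker : plus C.g x (C.Jp x (C.Xp x) + C.cp x • C.Xm x) (-C.g x (C.Xp x) (C.Xm x)) =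
      plus C.g x 0 0 := by
    rw [← hC.apply_plus hA]
    have e : plus C.g x 0 0 = 0 := by simp [plus]
    exact (hC.uplus_ker x).trans e.symm
  obtain ⟨k1, k2⟩ := (plus_inj _ _).1 ker
  -- The vector part gives `J₊X₋ = c₊X₊`, the scalar part `g(X₋, X₋) = 1 - c₊²`.
  have sq := hc.sq (plus C.g x 0 1)
  rw [hC.apply_plus hA, hC.apply_plus hA, Components.uplus, pairing_plus_plus, ← plus_smul,
    ← plus_neg, ← plus_add, plus_inj] at sq
  obtain ⟨s1, s2⟩ := sq
  simp at s1 s2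
  refine ⟨norm, by linarith, by linarith, fun v => ?_, fun v w => ?_,
    eq_neg_of_add_eq_zero_left k1, s1⟩
  · have := hc.sq (minus C.g x v)
    rw [hC.apply_minus hA, hC.apply_minus hA, Components.uplus, pairing_plus_minus, zero_smul,
      add_zero, ← minus_neg, minus_inj] at this
    exact this
  · have := hc.skew (minus C.g x v) (minus C.g x w)
    rw [hC.apply_minus hA, hC.apply_minus hA, pairing_minus_minus, pairing_minus_minus] at this
    linarith

lemma Components.Algebra.frame_expand {x : M} (h : C.Algebra x)
    (hN : C.g x (C.Xp x) (C.Xp x) ≠ 0) (v : TangentSpace (𝓡 2) x) :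
    v = ((C.g x (C.Xp x) (C.Xp x))⁻¹ * C.g x v (C.Xp x)) • C.Xp x
      + ((C.g x (C.Xp x) (C.Xp x))⁻¹ * C.g x v (C.Xm x)) • C.Xm x :=
  C.g.frame_expand x hN rfl h.norm_Xm h.orth v

/-- The sign `ε₀` as a function on `M`. -/
def Components.sign (C : Components M) (x : M) : ℝ :=
  -((C.g x (C.Xp x) (C.Xp x))⁻¹ * C.g x (C.Jm x (C.Xp x)) (C.Xm x))

/-- Skewness makes `J₋v` orthogonal to `v`, so `J₋` exchanges the two lines of the orthogonal frame;
`J₋² = -1` makes the factor a sign. `J₊` is compared with `J₋` on the same frame. -/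
lemma Components.Algebra.relations {x : M} (h : C.Algebra x)
    (hN : C.g x (C.Xp x) (C.Xp x) ≠ 0) : C.sign x ^ 2 = 1 ∧
    C.Jm x (C.Xp x) = -(C.sign x • C.Xm x) ∧ C.Jm x (C.Xm x) = C.sign x • C.Xp x ∧
    C.Jp x = (C.sign x * C.cp x) • C.Jm x := by
  have self : ∀ v, C.g x (C.Jm x v) v = 0 := fun v => by
    have := h.Jm_skew v v
    rw [C.g.symm x v] at this
    linarith
  have e1 : C.Jm x (C.Xp x) = -(C.sign x • C.Xm x) := by
    conv_lhs => rw [h.frame_expand hN (C.Jm x (C.Xp x)), self]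
    simp [sign]
  have e2 : C.Jm x (C.Xm x) = C.sign x • C.Xp x := by
    conv_lhs => rw [h.frame_expand hN (C.Jm x (C.Xm x)), self, h.Jm_skew, C.g.symm x (C.Xm x)]
    simp [sign]
  have e3 : C.sign x ^ 2 = 1 := by
    have := h.Jm_sq (C.Xp x)
    rw [e1, map_neg, map_smul, e2, smul_smul, neg_inj] at this
    have := congrArg (fun v => C.g x v (C.Xp x)) this
    simp only [map_smul, smul_apply, smul_eq_mul] at this
    rw [sq]
    exact mul_right_cancel₀ hN (by rw [this, one_mul])
  refine ⟨e3, e1, e2, ?_⟩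
  ext1 v
  rw [h.frame_expand hN v]
  simp only [map_add, map_smul, LinearMap.smul_apply, e1, e2, h.Jp_Xp, h.Jp_Xm, smul_neg,
    smul_smul]
  congr 2
  · congr 1
    linear_combination (-(C.g x (C.Xp x) (C.Xp x))⁻¹ * C.g x v (C.Xp x) * C.cp x) * e3
  · linear_combination (-(C.g x (C.Xp x) (C.Xp x))⁻¹ * C.g x v (C.Xm x) * C.cp x) * e3

lemma Components.smooth_sign (C : Components M) (hN : ∀ x, C.g x (C.Xp x) (C.Xp x) ≠ 0) :
    SmoothFun C.sign :=
  (((C.g.smooth_apply C.smooth_Xp C.smooth_Xp).inv hN).mul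
    (C.g.smooth_apply (C.smooth_Jm _ C.smooth_Xp) C.smooth_Xm)).neg

/-- The sign is a continuous function with square one, hence constant on a connected space. -/
lemma Components.exists_relations (C : Components M) (h : ∀ x, C.Algebra x)
    (hN : ∀ x, C.g x (C.Xp x) (C.Xp x) ≠ 0) [PreconnectedSpace M] :
    ∃ ε₀ : ℝ, (ε₀ = 1 ∨ ε₀ = -1) ∧ C.Relations ε₀ := by
  have hs := C.smooth_sign hN
  have hsq : Set.EqOn (C.sign ^ 2) 1 Set.univ := fun x _ => ((h x).relations (hN x)).1
  have := isPreconnected_univ.eq_one_or_eq_neg_one_of_sq_eq hs.continuous.continuousOn hsq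
  rcases this with e | e
  · refine ⟨1, Or.inl rfl, fun x => ?_⟩
    have := ((h x).relations (hN x)).2
    rwa [e (Set.mem_univ x)] at this
  · refine ⟨-1, Or.inr rfl, fun x => ?_⟩
    have := ((h x).relations (hN x)).2
    rwa [e (Set.mem_univ x)] at this

end Structure

end Pointwise

end BGen

end

noncomputable section

namespace BGen

/-! ### Sign and symmetry rules for `⟨[p, q], r⟩` -/

section BracketPairing

variable {M : Type*} [TopologicalSpace M] [ChartedSpace (EuclideanSpace ℝ (Fin 2)) M]
  [IsManifold (𝓡 2) ∞ M] (F : TwoForm M)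

lemma bracketPairing_compat_of_orthogonal {p q r : Sec M} (hp : SmoothSec p) (hq : SmoothSec q)
    (hr : SmoothSec r) (h : ∀ x, pairing x (q x) (r x) = 0) (x : M) :
    bracketPairing F p q r x = -bracketPairing F p r q x := by
  have := bracketPairing_compat F hp hq hr x
  simp only [h, dir_const] at this
  linarith

lemma bracketPairing_swap_of_orthogonal {p q r : Sec M} (hp : SmoothSec p) (hq : SmoothSec q)
    (hr : SmoothSec r) (h : ∀ x, pairing x (p x) (q x) = 0) (x : M) :
    bracketPairing F p q r x = -bracketPairing F q p r x := by
  have := bracketPairing_swap F hp hq hr x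
  simp only [h, dir_const] at this
  linarith

lemma bracketPairing_self_of_norm {p q : Sec M} (hp : SmoothSec p) (hq : SmoothSec q) {r : ℝ}
    (h : ∀ x, pairing x (q x) (q x) = r) (x : M) : bracketPairing F p q q x = 0 := by
  have := bracketPairing_compat F hp hq hq x
  simp only [h, dir_const] at this
  linarith

lemma bracketPairing_neg_right (p q r : Sec M) (x : M) :
    bracketPairing F p q (fun x => -r x) x = -bracketPairing F p q r x := by
  simp only [bracketPairing, map_neg]

/-- The sign is moved to the last slot, where the pairing is visibly linear; orthogonality removes
the derivative term. -/
lemma bracketPairing_neg_middle {p q r : Sec M} (hp : SmoothSec p) (hq : SmoothSec q)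
    (hr : SmoothSec r) (h : ∀ x, pairing x (q x) (r x) = 0) (x : M) :
    bracketPairing F p (fun x => -q x) r x = -bracketPairing F p q r x := by
  rw [bracketPairing_compat_of_orthogonal F hp hq.neg hr (fun x => by simp [h]),
    bracketPairing_neg_right, bracketPairing_compat_of_orthogonal F hp hq hr h]

lemma bracketPairing_neg_left {p q r : Sec M} (hp : SmoothSec p) (hq : SmoothSec q)
    (hr : SmoothSec r) (h : ∀ x, pairing x (p x) (r x) = 0) (x : M) :
    bracketPairing F (fun x => -p x) q r x = -bracketPairing F p q r x := by
  have h1 := bracketPairing_swap F hp hq hr x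
  have h2 := bracketPairing_swap F hp.neg hq hr x
  simp only [map_neg, LinearMap.neg_apply] at h2
  rw [dir_neg, bracketPairing_neg_middle F hq hp hr h] at h2
  linarith

end BracketPairing

/-! ### Consequences of integrability for the components -/

section Necessity

variable {M : Type*} [TopologicalSpace M] [ChartedSpace (EuclideanSpace ℝ (Fin 2)) M]
  [IsManifold (𝓡 2) ∞ M] {F : TwoForm M} {G : GenMetric M} {A : EndField M} {C : Components M}

lemma minus_smooth (g : PseudoMetric M) {Y : VField M} (hY : SmoothVField Y) :
    SmoothSec fun x => minus g x (Y x) :=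
  ⟨hY, (g.smooth.apply hY).neg, smoothFun_const 0⟩

lemma plus_smooth (g : PseudoMetric M) {Y : VField M} {l : M → ℝ} (hY : SmoothVField Y)
    (hl : SmoothFun l) : SmoothSec fun x => plus g x (Y x) (l x) :=
  ⟨hY, g.smooth.apply hY, hl⟩

/-- Integrability of `𝓕` and `𝒢^end 𝓕` means that `[v, u₊] ∈ E₋` for all sections `v` of `E₋`. -/
lemma IsPseudoKahler.bracketPairing_uplus (hK : IsPseudoKahler F G A) (hC : HasComponents G A C)
    {Y W : VField M} {l : M → ℝ} (hY : SmoothVField Y) (hW : SmoothVField W) (hl : SmoothFun l)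
    (x : M) : bracketPairing F (fun x => minus C.g x (Y x)) C.uplus
      (fun x => plus C.g x (W x) (l x)) x = 0 := by
  have hA := hK.almostHermitian
  have hs := hA.almostComplex.smooth
  set g := C.g with hg
  set v : Sec M := fun x => minus g x (Y x) with hv
  set w : Sec M := fun x => plus g x (W x) (l x) with hw
  have sv : SmoothSec v := minus_smooth g hY
  have sw : SmoothSec w := plus_smooth g hW hl
  have su := C.smooth_uplus
  have hc := hC.isHyperplaneComplex hA
  have Av : ∀ x, A x (v x) = minus g x (C.Jm x (Y x)) := fun x => hC.apply_minus hA x _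
  have AAv : ∀ x, A x (A x (v x)) = -v x := fun x => by
    rw [Av, hC.apply_minus hA, (hC.algebra hA x).Jm_sq, minus_neg]
  have Aw : ∀ x, ∃ z m, A x (w x) = plus g x z m := fun x => ⟨_, _, hC.apply_plus hA x _ _⟩
  have AAw : ∀ x, ∃ z m, A x (A x (w x)) = plus g x z m := fun x => by
    obtain ⟨z, m, e⟩ := Aw x
    exact ⟨_, _, by rw [e, hC.apply_plus hA]⟩
  have AAAw : ∀ x, A x (A x (A x (w x))) = -A x (w x) := fun x => by
    rw [(hc x).sq (A x (w x)), pairing_symm, (hc x).skew,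
      show A x (C.uplus x) = 0 from hC.uplus_ker x]
    simp
  have Gv : ∀ x, G.gend x (v x) = -v x := fun x => hC.isStandard.gend_minus _
  have GAv : ∀ x, G.gend x (A x (v x)) = -A x (v x) := fun x => by
    rw [Av, hC.isStandard.gend_minus]
  have GAw : ∀ x, G.gend x (A x (w x)) = A x (w x) := fun x => by
    obtain ⟨z, m, e⟩ := Aw x
    rw [e, hC.isStandard.gend_plus]
  have GAAw : ∀ x, G.gend x (A x (A x (w x))) = A x (A x (w x)) := fun x => by
    obtain ⟨z, m, e⟩ := AAw x
    rw [e, hC.isStandard.gend_plus]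
  have sAv := hs v sv
  have sAw := hs w sw
  have sAAw := hs _ sAw
  have huA : ∀ x z, pairing x (A x z) (C.uplus x) = 0 := fun x z => by
    rw [(hc x).skew, show A x (C.uplus x) = 0 from hC.uplus_ker x, map_zero, neg_zero]
  have hvu : ∀ x, pairing x (v x) (C.uplus x) = 0 := fun x => pairing_minus_plus _ _ _ _ _
  have hAvu : ∀ x, pairing x (A x (v x)) (C.uplus x) = 0 := fun x => huA x _
  -- `A²w + iAw` and `-v + iAv` are sections of the `i`-eigenbundle of `𝓕`.
  have e1 := cpair_mem_eigenspace_I.1 (hK.integrable _ _ _ _ sAAw sAw sv.neg sAv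
    (fun x => cpair_mem_eigenspace_I.2 ⟨AAAw x, rfl⟩)
    (fun x => cpair_mem_eigenspace_I.2 ⟨map_neg _ _, AAv x⟩) x)
  -- On `E₋` the sign of `𝒢^end 𝓕` is opposite to that of `𝓕`, so the same section of `E₊ ⊗ ℂ` is
  -- now bracketed with the conjugate `-v - iAv`.
  have e2 := cpair_mem_eigenspace_I.1 (hK.integrable_two _ _ _ _ sAAw sAw sv.neg sAv.neg
    (fun x => cpair_mem_eigenspace_I.2 ⟨by
      simp only [LinearMap.comp_apply]; rw [AAAw, map_neg, GAw], by
      simp only [LinearMap.comp_apply]; rw [GAAw]⟩)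
    (fun x => cpair_mem_eigenspace_I.2 ⟨by
      simp only [LinearMap.comp_apply]; rw [map_neg, map_neg, GAv], by
      simp only [LinearMap.comp_apply]; rw [map_neg, AAv, neg_neg, Gv]⟩) x)
  -- The real part of each bracket lies in the image of `A`, which is orthogonal to `u₊`.
  have f1 := huA x ((dorfman F (fun x => A x (A x (w x))) (fun x => A x (v x)) +
    dorfman F (fun x => A x (w x)) (fun x => -v x)) x)
  rw [e1.2] at f1
  have f2 := huA x (G.gend x ((dorfman F (fun x => A x (A x (w x))) (fun x => -A x (v x)) +
    dorfman F (fun x => A x (w x)) (fun x => -v x)) x))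
  have comm := DFunLike.congr_fun (hA.commute x)
    ((dorfman F (fun x => A x (A x (w x))) (fun x => -A x (v x)) +
    dorfman F (fun x => A x (w x)) (fun x => -v x)) x)
  have e22 := e2.2
  simp only [LinearMap.comp_apply] at comm e22
  rw [← comm, e22] at f2
  have g1 : bracketPairing F (fun x => A x (A x (w x))) (fun x => -v x) C.uplus x -
      bracketPairing F (fun x => A x (w x)) (fun x => A x (v x)) C.uplus x = 0 := by
    rw [← f1]; simp [bracketPairing]
  have g2 : bracketPairing F (fun x => A x (A x (w x))) (fun x => -v x) C.uplus x -
      bracketPairing F (fun x => A x (w x)) (fun x => -A x (v x)) C.uplus x = 0 := by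
    rw [← f2]; simp [bracketPairing]
  rw [bracketPairing_neg_middle F sAAw sv su hvu] at g1 g2
  rw [bracketPairing_neg_middle F sAw sAv su hAvu] at g2
  -- Adding the relations for `v` and its conjugate cancels the terms containing `Aw` and `Av`.
  have k1 : bracketPairing F (fun x => A x (A x (w x))) v C.uplus x = 0 := by linarith
  rw [bracketPairing_swap_of_orthogonal F sAAw sv su (fun x => by
      obtain ⟨z, m, e⟩ := AAw x
      rw [e]; exact pairing_plus_minus _ _ _ _ _),
    bracketPairing_compat_of_orthogonal F sv sAAw su (fun x => huA x _), neg_neg] at k1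
  -- `A²w` differs from `-w` by a multiple of `u₊`, which contributes nothing because `⟨u₊, u₊⟩` is
  -- constant.
  have k2 := bracketPairing_self_of_norm F sv su hC.uplus_norm x
  simp only [bracketPairing, (hc x).sq, map_add, map_neg, map_smul, smul_eq_mul] at k1 k2 ⊢
  rw [k2] at k1
  linarith

/-- The differential equations satisfied by the components of a pseudo-Kähler structure. -/
lemma IsPseudoKahler.equations (hK : IsPseudoKahler F G A) (hC : HasComponents G A C)
    {Y Z : VField M} (hY : SmoothVField Y) (hZ : SmoothVField Z) (x : M) :
    leviCivita C.g Y C.Xp Z x = C.cp x * F x (Y x) (Z x) ∧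
      dir Y C.cp x = -F x (Y x) (C.Xp x) := by
  -- Testing against `E₊` with scalar parts `0` and `1` separates the two equations.
  have h0 := hK.bracketPairing_uplus hC hY hZ (smoothFun_const 0) x
  have h1 := hK.bracketPairing_uplus hC hY hZ (smoothFun_const 1) x
  have e := fun (l : M → ℝ) (hl : SmoothFun l) =>
    bracketPairing_plus_minus F C.g hZ C.smooth_Xp hY hl C.smooth_cp x
  have h0' := (e _ (smoothFun_const 0)).symm.trans h0
  have h1' := (e _ (smoothFun_const 1)).symm.trans h1
  constructor <;> linarith

/-- In dimension two an alternating form is determined by its value on one frame. -/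
lemma TwoForm.eq_zero_of_frame (F : TwoForm M) {x : M} (hC : C.Algebra x)
    (hN : C.g x (C.Xp x) (C.Xp x) ≠ 0) (h : F x (C.Xm x) (C.Xp x) = 0) : F x = 0 := by
  have h' : F x (C.Xp x) (C.Xm x) = 0 := by rw [F.swap, h, neg_zero]
  ext v w
  rw [hC.frame_expand hN v, hC.frame_expand hN w]
  simp [h, h', F.alt]

/-- `g(∇_Y X₊, Z) = c₊ F(Y, Z)` is alternating, so its symmetric part `ℒ_{X₊} g` vanishes. -/
lemma IsPseudoKahler.isKilling (hK : IsPseudoKahler F G A) (hC : HasComponents G A C) :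
    IsKilling C.g C.Xp := by
  intro Y Z hY hZ x
  have h := leviCivita_symm_eq C.g C.Xp Y Z x
  rw [(hK.equations hC hY hZ x).1, (hK.equations hC hZ hY x).1, F.swap x (Z x)] at h
  linarith

/-- Skew-symmetrizing `∇X₊ = c₊F` gives `dX₊^♭ = 2c₊F`. -/
lemma IsPseudoKahler.isHalfD (hK : IsPseudoKahler F G A) (hC : HasComponents G A C)
    (h0 : ∀ x, C.cp x ≠ 0) : IsHalfD F C.cp C.g C.Xp := by
  intro Y Z hY hZ x
  rw [← leviCivita_skew_eq, (hK.equations hC hY hZ x).1, (hK.equations hC hZ hY x).1,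
    F.swap x (Z x)]
  have := h0 x
  field_simp
  ring

lemma IsPseudoKahler.isParallel (hK : IsPseudoKahler F G A) (hC : HasComponents G A C)
    (h : ∀ x, F x = 0) : IsParallel C.g C.Xp := by
  intro Y Z hY hZ x
  rw [(hK.equations hC hY hZ x).1, h x]
  simp

/-- For constant `c₊` the second equation gives `F(X₋, X₊) = -dc₊(X₋) = 0`. This serves both the
case `c₊ = 0` and Lie groups. -/
lemma IsPseudoKahler.form_eq_zero (hK : IsPseudoKahler F G A) (hC : HasComponents G A C)
    (hN : C.NonNull) {r : ℝ} (h : ∀ x, C.cp x = r) (x : M) : F x = 0 := by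
  refine F.eq_zero_of_frame (hC.algebra hK.almostHermitian x) (hN x).1 ?_
  have := (hK.equations hC C.smooth_Xm C.smooth_Xm x).2
  rw [show C.cp = fun _ => r from funext h, dir_const] at this
  linarith

end Necessity

/-! ### Integrability tested on a frame of the eigenbundle -/

section Criterion

variable {V : Type*} [AddCommGroup V] [Module ℝ V]

/-- This is `(L ⊕ ℂu)^⊥ ⊆ L`. Pairing with the vectors `A v - iA²v` of `L` and moving `A` across by
skewness gives the eigenvalue equations against every `v`. -/
lemma IsHyperplaneComplex.mem_eigenspace_of_orthogonal {B : LinearMap.BilinForm ℝ V}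
    {A : V →ₗ[ℝ] V} {u : V} (h : IsHyperplaneComplex B A u) (hB : ∀ v w, B v w = B w v)
    (huu : B u u = 1) (hAu : A u = 0) (hnd : ∀ v, (∀ w, B v w = 0) → v = 0) {s : ℂ ⊗[ℝ] V}
    (hs : ∀ t ∈ Module.End.eigenspace (A.baseChange ℂ) Complex.I, B.baseChange ℂ s t = 0)
    (hsu : B.baseChange ℂ s (cpair u 0) = 0) :
    s ∈ Module.End.eigenspace (A.baseChange ℂ) Complex.I := by
  obtain ⟨a, b, rfl⟩ := exists_cpair s
  rw [baseChange_form_cpair_eq_zero] at hsu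
  simp only [map_zero, sub_zero, zero_add] at hsu
  obtain ⟨ha, hb⟩ := hsu
  rw [cpair_mem_eigenspace_I]
  have key : ∀ v, B a (A v) - B b (-A (A v)) = 0 ∧ B a (-A (A v)) + B b (A v) = 0 := by
    intro v
    have hv : A v ∈ sqNegOne A := by
      rw [h.mem_sqNegOne_iff huu, hB, h.skew, hAu, map_zero, neg_zero]
    exact baseChange_form_cpair_eq_zero.1 (hs _ (cpair_sub_mem hv))
  constructor
  · rw [← sub_eq_zero]
    refine hnd _ fun v => ?_
    have := (key v).1
    rw [h.sq] at this
    simp only [map_neg, map_add, map_smul, smul_eq_mul, hb] at this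
    simp only [map_sub, map_neg, LinearMap.sub_apply, LinearMap.neg_apply, h.skew]
    linarith
  · rw [← sub_eq_zero]
    refine hnd _ fun v => ?_
    have := (key v).2
    rw [h.sq] at this
    simp only [map_neg, map_add, map_smul, smul_eq_mul, ha] at this
    simp only [map_sub, LinearMap.sub_apply, h.skew]
    linarith

lemma exists_complex_combination {A : V →ₗ[ℝ] V} {m n : V} (hm : m ∈ sqNegOne A)
    (hn : n ∈ sqNegOne A)
    (h : ∀ w ∈ sqNegOne A, ∃ α β γ δ : ℝ, w = α • m + β • A m + γ • n + δ • A n)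
    {t : ℂ ⊗[ℝ] V} (ht : t ∈ Module.End.eigenspace (A.baseChange ℂ) Complex.I) :
    ∃ α β : ℂ, t = α • cpair m (-A m) + β • cpair n (-A n) := by
  obtain ⟨a, b, rfl⟩ := exists_cpair t
  rw [cpair_mem_eigenspace_I] at ht
  obtain ⟨α, β, γ, δ, e⟩ := h a (by rw [mem_sqNegOne, ht.1, map_neg, ht.2])
  -- The real part of `(α + iβ)(m - iAm)` is `αm + βAm`.
  refine ⟨⟨α, β⟩, ⟨γ, δ⟩, ?_⟩
  rw [mem_sqNegOne] at hm hn
  have eb : b = -A a := by rw [ht.1, neg_neg]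
  rw [smul_cpair, smul_cpair, cpair_add, cpair_inj, eb, e]
  constructor
  · module
  · simp only [map_add, map_smul, hm, hn]
    module

variable {M : Type*} [TopologicalSpace M] [ChartedSpace (EuclideanSpace ℝ (Fin 2)) M]
  [IsManifold (𝓡 2) ∞ M] (F : TwoForm M)

/-- The pairing of the complexified bracket `[p₁ + i p₂, q₁ + i q₂]` with `r₁ + i r₂`. -/
def bracketPairingC (p q r : Sec M × Sec M) (x : M) : ℂ :=
  pairingC x (cplx (dorfman F p.1 q.1 - dorfman F p.2 q.2)
    (dorfman F p.1 q.2 + dorfman F p.2 q.1) x) (cplx r.1 r.2 x)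

/-- Smooth sections of `E ⊗ ℂ`. -/
def SmoothSecC (p : Sec M × Sec M) : Prop := SmoothSec p.1 ∧ SmoothSec p.2

/-- Orthogonality of sections of `E ⊗ ℂ`. -/
def OrthoC (p q : Sec M × Sec M) : Prop :=
  ∀ x, pairingC x (cplx p.1 p.2 x) (cplx q.1 q.2 x) = 0

lemma bracketPairingC_eq (p q r : Sec M × Sec M) (x : M) :
    bracketPairingC F p q r x =
      ((bracketPairing F p.1 q.1 r.1 x - bracketPairing F p.2 q.2 r.1 x
        - bracketPairing F p.1 q.2 r.2 x - bracketPairing F p.2 q.1 r.2 x : ℝ) : ℂ) +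
      ((bracketPairing F p.1 q.1 r.2 x - bracketPairing F p.2 q.2 r.2 x
        + bracketPairing F p.1 q.2 r.1 x + bracketPairing F p.2 q.1 r.1 x : ℝ) : ℂ) *
          Complex.I := by
  rw [bracketPairingC]
  refine (baseChange_form_cpair _ _ _ _ _).trans ?_
  simp only [bracketPairing, Pi.sub_apply, Pi.add_apply, map_sub, map_add, LinearMap.sub_apply,
    LinearMap.add_apply]
  apply Complex.ext <;> simp <;> ring

lemma OrthoC.dir_eq {p q : Sec M × Sec M} (h : OrthoC p q) (X : VField M) (x : M) :
    dir X (fun x => pairing x (p.1 x) (q.1 x)) x = dir X (fun x => pairing x (p.2 x) (q.2 x)) x ∧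
    dir X (fun x => pairing x (p.1 x) (q.2 x)) x =
      -dir X (fun x => pairing x (p.2 x) (q.1 x)) x := by
  have h1 := fun x => baseChange_form_cpair_eq_zero.1 (h x)
  constructor
  · congr 1
    exact funext fun x => by linarith [(h1 x).1]
  · rw [← dir_neg]
    congr 1
    exact funext fun x => by linarith [(h1 x).2]

/-- The real axiom holds for each of the eight terms, and complex orthogonality makes the derivative
terms cancel. -/
lemma bracketPairingC_compat {p q r : Sec M × Sec M} (hp : SmoothSecC p) (hq : SmoothSecC q)
    (hr : SmoothSecC r) (h : OrthoC q r) (x : M) :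
    bracketPairingC F p q r x = -bracketPairingC F p r q x := by
  have c := @bracketPairing_compat M _ _ _ F
  have d := h.dir_eq
  have c1 := c hp.1 hq.1 hr.1 x
  have c2 := c hp.2 hq.2 hr.1 x
  have c3 := c hp.1 hq.2 hr.2 x
  have c4 := c hp.2 hq.1 hr.2 x
  have c5 := c hp.1 hq.1 hr.2 x
  have c6 := c hp.2 hq.2 hr.2 x
  have c7 := c hp.1 hq.2 hr.1 x
  have c8 := c hp.2 hq.1 hr.1 x
  have d1 := d (fun x => (p.1 x).1) x
  have d2 := d (fun x => (p.2 x).1) x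
  rw [bracketPairingC_eq, bracketPairingC_eq]
  apply Complex.ext <;> simp <;> linarith [d1.1, d1.2, d2.1, d2.2]

lemma bracketPairingC_swap {p q r : Sec M × Sec M} (hp : SmoothSecC p) (hq : SmoothSecC q)
    (hr : SmoothSecC r) (h : OrthoC p q) (x : M) :
    bracketPairingC F p q r x = -bracketPairingC F q p r x := by
  have c := @bracketPairing_swap M _ _ _ F
  have d := h.dir_eq
  have c1 := c hp.1 hq.1 hr.1 x
  have c2 := c hp.2 hq.2 hr.1 x
  have c3 := c hp.1 hq.2 hr.2 x
  have c4 := c hp.2 hq.1 hr.2 x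
  have c5 := c hp.1 hq.1 hr.2 x
  have c6 := c hp.2 hq.2 hr.2 x
  have c7 := c hp.1 hq.2 hr.1 x
  have c8 := c hp.2 hq.1 hr.1 x
  have d1 := d (fun x => (r.1 x).1) x
  have d2 := d (fun x => (r.2 x).1) x
  rw [bracketPairingC_eq, bracketPairingC_eq]
  apply Complex.ext <;> simp <;> linarith [d1.1, d1.2, d2.1, d2.2]

lemma bracketPairingC_combination (p q : Sec M × Sec M) {r m n : Sec M × Sec M} {x : M} {α β : ℂ}
    (h : cplx r.1 r.2 x = α • cplx m.1 m.2 x + β • cplx n.1 n.2 x) :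
    bracketPairingC F p q r x =
      α * bracketPairingC F p q m x + β * bracketPairingC F p q n x := by
  simp only [bracketPairingC, h, map_add, map_smul, smul_eq_mul]

/-- Smooth sections of the `i`-eigenbundle. -/
def IsEigenSec (A : EndField M) (p : Sec M × Sec M) : Prop :=
  SmoothSecC p ∧ ∀ x, cplx p.1 p.2 x ∈ eigenC A Complex.I x

variable {F} {A : EndField M} {u : Sec M}

/-- If `r` is orthogonal to the `i`-eigenbundle `L`, then `⟨[p, q], r⟩` is an alternating
form on `L`. -/
lemma bracketPairingC_eq_zero {m n r p q : Sec M × Sec M}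
    (iso : ∀ p q, IsEigenSec A p → IsEigenSec A q → OrthoC p q)
    (hm : IsEigenSec A m) (hn : IsEigenSec A n) (hr : SmoothSecC r)
    (hr' : ∀ p, IsEigenSec A p → OrthoC p r) {x : M}
    (span : ∀ t ∈ eigenC A Complex.I x,
      ∃ α β : ℂ, t = α • cplx m.1 m.2 x + β • cplx n.1 n.2 x)
    (h : bracketPairingC F m n r x = 0) (hp : IsEigenSec A p) (hq : IsEigenSec A q) :
    bracketPairingC F p q r x = 0 := by
  have swap : ∀ p q, IsEigenSec A p → IsEigenSec A q →
      bracketPairingC F p q r x = -bracketPairingC F q p r x := fun p q hp hq =>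
    bracketPairingC_swap F hp.1 hq.1 hr (iso p q hp hq) x
  have self : ∀ p, IsEigenSec A p → bracketPairingC F p p r x = 0 := fun p hp => by
    have := swap p p hp hp
    exact self_eq_neg.1 this
  -- The middle argument is moved to the last slot, where expansion in the frame is pointwise linear
  -- and no derivatives of coefficients appear.
  have right : ∀ p q, IsEigenSec A p → IsEigenSec A q → bracketPairingC F p m r x = 0 →
      bracketPairingC F p n r x = 0 → bracketPairingC F p q r x = 0 := by
    intro p q hp hq h1 h2
    obtain ⟨α, β, e⟩ := span _ (hq.2 x)
    rw [bracketPairingC_compat F hp.1 hq.1 hr (hr' q hq), bracketPairingC_combination F p r e]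
    rw [bracketPairingC_compat F hp.1 hm.1 hr (hr' m hm)] at h1
    rw [bracketPairingC_compat F hp.1 hn.1 hr (hr' n hn)] at h2
    rw [neg_eq_zero.1 h1, neg_eq_zero.1 h2]
    simp
  refine right p q hp hq ?_ ?_
  · rw [swap p m hp hm, right m p hm hp (self m hm) h, neg_zero]
  · rw [swap p n hp hn, right n p hn hp (by rw [swap n m hn hm, h, neg_zero]) (self n hn),
      neg_zero]

/-- A criterion for integrability in terms of a frame of the `i`-eigenbundle. -/
lemma isIntegrable_of_frame (hA : ∀ v, SmoothSec v → SmoothSec fun x => A x (v x))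
    (hu : SmoothSec u) (hc : ∀ x, IsHyperplaneComplex (pairing x) (A x) (u x))
    (huu : ∀ x, pairing x (u x) (u x) = 1) (hAu : ∀ x, A x (u x) = 0)
    (hnd : ∀ x, ∀ v : Fiber M x, (∀ w, pairing x v w = 0) → v = 0)
    {m n : Sec M} (hm : SmoothSec m) (hn : SmoothSec n)
    (hm' : ∀ x, m x ∈ sqNegOne (A x)) (hn' : ∀ x, n x ∈ sqNegOne (A x))
    (span : ∀ x, ∀ w ∈ sqNegOne (A x), ∃ α β γ δ : ℝ,
      w = α • m x + β • A x (m x) + γ • n x + δ • A x (n x))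
    (h : ∀ x, bracketPairing F m n u x = 0 ∧ bracketPairing F m (fun x => A x (n x)) u x = 0 ∧
      bracketPairing F (fun x => A x (m x)) n u x = 0 ∧
      bracketPairing F (fun x => A x (m x)) (fun x => A x (n x)) u x = 0) :
    IsIntegrable F A := by
  intro a b c d ha hb hcs hd hab hcd x
  set lm : Sec M × Sec M := (m, fun x => -A x (m x)) with hlm
  set ln : Sec M × Sec M := (n, fun x => -A x (n x)) with hln
  have em : IsEigenSec A lm := ⟨⟨hm, (hA m hm).neg⟩, fun x => cpair_sub_mem (hm' x)⟩
  have en : IsEigenSec A ln := ⟨⟨hn, (hA n hn).neg⟩, fun x => cpair_sub_mem (hn' x)⟩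
  have iso : ∀ p q, IsEigenSec A p → IsEigenSec A q → OrthoC p q :=
    fun p q hp hq x => (hc x).isotropic _ (hp.2 x) _ (hq.2 x)
  have spanC : ∀ t ∈ eigenC A Complex.I x,
      ∃ α β : ℂ, t = α • cplx lm.1 lm.2 x + β • cplx ln.1 ln.2 x :=
    fun t ht => exists_complex_combination (hm' x) (hn' x) (span x) ht
  have ep : IsEigenSec A (a, b) := ⟨⟨ha, hb⟩, hab⟩
  have eq : IsEigenSec A (c, d) := ⟨⟨hcs, hd⟩, hcd⟩
  -- On `L` the form `⟨[p, q], r⟩` is alternating in all three arguments, so it vanishes when `r`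
  -- repeats a frame section.
  have zm : bracketPairingC F (a, b) (c, d) lm x = 0 := by
    refine bracketPairingC_eq_zero iso em en em.1 (fun p hp => iso p _ hp em) spanC ?_ ep eq
    rw [bracketPairingC_compat F em.1 en.1 em.1 (iso _ _ en em), neg_eq_zero]
    exact self_eq_neg.1 (bracketPairingC_swap F em.1 em.1 en.1 (iso _ _ em em) x)
  have zn : bracketPairingC F (a, b) (c, d) ln x = 0 := by
    refine bracketPairingC_eq_zero iso em en en.1 (fun p hp => iso p _ hp en) spanC ?_ ep eq
    have s := self_eq_neg.1 (bracketPairingC_compat F em.1 en.1 en.1 (iso _ _ en en) x)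
    exact s
  have z0 : SmoothSec (fun x => (0 : Fiber M x)) :=
    ⟨smoothVField_zero, smoothOneForm_zero, smoothFun_const 0⟩
  have huL : ∀ x, ∀ w : Fiber M x, pairing x (A x w) (u x) = 0 := fun x w => by
    rw [(hc x).skew, hAu, map_zero, neg_zero]
  -- The only condition not automatic in rank two: its real and imaginary parts on the frame are
  -- combinations of the four brackets assumed to vanish.
  have zu : bracketPairingC F (a, b) (c, d) (u, fun x => 0) x = 0 := by
    refine bracketPairingC_eq_zero iso em en ⟨hu, z0⟩ (fun p hp x => ?_) spanC ?_ ep eq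
    · have hpx := cpair_mem_eigenspace_I.1 (hp.2 x)
      refine baseChange_form_cpair_eq_zero.2 ?_
      have h1 : pairing x (p.1 x) (u x) = 0 := by rw [← hpx.2, huL]
      have h2 : pairing x (p.2 x) (u x) = 0 := by
        rw [← neg_neg (p.2 x), ← hpx.1, map_neg, LinearMap.neg_apply, huL, neg_zero]
      simp [h1, h2]
    · obtain ⟨h1, h2, h3, h4⟩ := h x
      have z : ∀ p q : Sec M, bracketPairing F p q (fun x => 0) x = 0 := fun p q => by
        simp [bracketPairing]
      have sAm := hA m hm
      have sAn := hA n hn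
      have e1 := bracketPairing_neg_middle F hm sAn hu (fun x => huL x _) x
      have e2 := bracketPairing_neg_left F sAm hn hu (fun x => huL x _) x
      have e3 := bracketPairing_neg_left F sAm sAn.neg hu (fun x => huL x _) x
      have e4 := bracketPairing_neg_middle F sAm sAn hu (fun x => huL x _) x
      rw [bracketPairingC_eq]
      simp only [hlm, hln, z, e1, e2, e3, e4, h1, h2, h3, h4]
      simp
  refine (hc x).mem_eigenspace_of_orthogonal (pairing_symm x) (huu x) (hAu x) (hnd x) ?_ zu
  intro t ht
  obtain ⟨α, β, rfl⟩ := spanC t ht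
  rw [map_add, map_smul, map_smul]
  have zm' : pairingC x _ _ = 0 := zm
  have zn' : pairingC x _ _ = 0 := zn
  simp only [pairingC] at zm' zn'
  erw [zm', zn']
  simp

end Criterion

end BGen

end

noncomputable section

namespace BGen

/-! ### Building the structure from its components -/

section Sufficiency

variable {M : Type*} [TopologicalSpace M] [ChartedSpace (EuclideanSpace ℝ (Fin 2)) M]
  [IsManifold (𝓡 2) ∞ M]

/-- The generalized metric `E₋ = {X - i_X g}`. -/
def PseudoMetric.standard (g : PseudoMetric M) : GenMetric M where
  Eminus x :=
    { carrier := {u | u.2.1 = -g x u.1 ∧ u.2.2 = 0}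
      add_mem' := fun {u v} hu hv => by
        refine ⟨?_, ?_⟩
        · simp only [Prod.fst_add, Prod.snd_add, map_add, hu.1, hv.1, neg_add]
        · simp only [Prod.snd_add, hu.2, hv.2, add_zero]
      zero_mem' := by simp
      smul_mem' := fun r u hu => by
        refine ⟨?_, ?_⟩
        · simp only [Prod.smul_fst, Prod.smul_snd, map_smul, hu.1, smul_neg]
        · simp only [Prod.smul_snd, hu.2, smul_zero] }
  nondeg x := by
    have eq : ∀ u : Fiber M x, (u.2.1 = -g x u.1 ∧ u.2.2 = 0) → u = minus g x u.1 :=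
      fun u hu => Prod.ext rfl (Prod.ext hu.1 hu.2)
    constructor
    · rintro ⟨u, hu⟩ h
      have hz : u.1 = 0 := g.nondeg x _ fun w => by
        have h1 : pairing x u (minus g x w) = 0 := h ⟨minus g x w, rfl, rfl⟩
        rw [eq u hu, pairing_minus_minus] at h1
        linarith
      apply Subtype.ext
      change u = 0
      rw [eq u hu, hz]
      simp [minus]
    · rintro ⟨u, hu⟩ h
      have hz : u.1 = 0 := g.nondeg x _ fun w => by
        have h1 : pairing x (minus g x w) u = 0 := h ⟨minus g x w, rfl, rfl⟩
        rw [eq u hu, pairing_minus_minus, g.symm] at h1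
        linarith
      apply Subtype.ext
      change u = 0
      rw [eq u hu, hz]
      simp [minus]
  admissible x v := by
    refine ⟨minus g x v, ⟨⟨rfl, rfl⟩, rfl⟩, ?_⟩
    rintro u ⟨hu, rfl⟩
    exact Prod.ext rfl (Prod.ext hu.1 hu.2)
  smooth u hu hs := by
    have e : u = fun x => minus g x (u x).1 :=
      funext fun x => Prod.ext rfl (Prod.ext (hu x).1 (hu x).2)
    rw [e]
    exact minus_smooth g hs

lemma PseudoMetric.isStandard_standard (g : PseudoMetric M) : IsStandard g.standard g :=
  fun _ _ => Iff.rfl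

namespace Components

variable (C : Components M)

/-- The vector dual to a `1`-form, in terms of the frame `(X₊, X₋)`. -/
def sharp (x : M) : (TangentSpace (𝓡 2) x →L[ℝ] ℝ) →ₗ[ℝ] TangentSpace (𝓡 2) x where
  toFun ξ := ((C.g x (C.Xp x) (C.Xp x))⁻¹ * ξ (C.Xp x)) • C.Xp x
    + ((C.g x (C.Xp x) (C.Xp x))⁻¹ * ξ (C.Xm x)) • C.Xm x
  map_add' ξ η := by simp only [add_apply]; module
  map_smul' r ξ := by simp only [smul_apply, smul_eq_mul, RingHom.id_apply]; module

variable {C} in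
lemma Algebra.sharp_apply {x : M} (h : C.Algebra x) (hN : C.g x (C.Xp x) (C.Xp x) ≠ 0)
    (v : TangentSpace (𝓡 2) x) : C.sharp x (C.g x v) = v := (h.frame_expand hN v).symm

/-- The endomorphism of `E` acting by `J₋` on `E₋ ≅ TM` and by `J₊`, `X₋` on `E₊ ≅ TM ⊕ ℝ`. -/
def toEnd : EndField M := fun x =>
  { toFun := fun u => minus C.g x (C.Jm x ((1 / 2 : ℝ) • (u.1 - C.sharp x u.2.1))) +
      plus C.g x (C.Jp x ((1 / 2 : ℝ) • (u.1 + C.sharp x u.2.1)) + u.2.2 • C.Xm x)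
        (-C.g x ((1 / 2 : ℝ) • (u.1 + C.sharp x u.2.1)) (C.Xm x))
    map_add' := fun u v => by
      have e : ∀ a b c d : Fiber M x, a + b + (c + d) = (a + c) + (b + d) :=
        fun a b c d => add_add_add_comm a b c d
      rw [e, ← minus_add, ← plus_add]
      simp only [Prod.fst_add, Prod.snd_add, map_add, map_sub, map_smul, add_smul, add_apply,
        smul_apply, smul_eq_mul]
      congr 2
      · module
      · module
      · ring
    map_smul' := fun r u => by
      have e : ∀ a b : Fiber M x, r • (a + b) = r • a + r • b := fun a b => smul_add r a b
      rw [RingHom.id_apply, e, ← minus_smul, ← plus_smul]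
      simp only [Prod.smul_fst, Prod.smul_snd, map_add, map_sub, map_smul, add_apply,
        smul_apply, smul_eq_mul]
      congr 2
      · module
      · module
      · ring }

variable {C}

lemma toEnd_minus {x : M} (h : C.Algebra x) (hN : C.g x (C.Xp x) (C.Xp x) ≠ 0)
    (v : TangentSpace (𝓡 2) x) : C.toEnd x (minus C.g x v) = minus C.g x (C.Jm x v) := by
  have e1 : (1 / 2 : ℝ) • (v - -v) = v := by module
  have e2 : (1 / 2 : ℝ) • (v + -v) = 0 := by module
  change minus C.g x (C.Jm x ((1 / 2 : ℝ) • (v - C.sharp x (-C.g x v)))) +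
      plus C.g x (C.Jp x ((1 / 2 : ℝ) • (v + C.sharp x (-C.g x v))) + (0 : ℝ) • C.Xm x)
        (-C.g x ((1 / 2 : ℝ) • (v + C.sharp x (-C.g x v))) (C.Xm x)) = _
  rw [map_neg, h.sharp_apply hN, e1, e2]
  simp [plus]

lemma toEnd_plus {x : M} (h : C.Algebra x) (hN : C.g x (C.Xp x) (C.Xp x) ≠ 0)
    (v : TangentSpace (𝓡 2) x) (l : ℝ) : C.toEnd x (plus C.g x v l) =
      plus C.g x (C.Jp x v + l • C.Xm x) (-C.g x v (C.Xm x)) := by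
  have e1 : (1 / 2 : ℝ) • (v + v) = v := by module
  change minus C.g x (C.Jm x ((1 / 2 : ℝ) • (v - C.sharp x (C.g x v)))) +
      plus C.g x (C.Jp x ((1 / 2 : ℝ) • (v + C.sharp x (C.g x v))) + l • C.Xm x)
        (-C.g x ((1 / 2 : ℝ) • (v + C.sharp x (C.g x v))) (C.Xm x)) = _
  rw [h.sharp_apply hN, e1, sub_self]
  simp [minus]

lemma Algebra.Jp_skew {x : M} (h : C.Algebra x) (hN : C.g x (C.Xp x) (C.Xp x) ≠ 0)
    (v w : TangentSpace (𝓡 2) x) : C.g x (C.Jp x v) w = -C.g x v (C.Jp x w) := by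
  rw [(h.relations hN).2.2.2]
  simp [h.Jm_skew]

lemma Algebra.Jp_sq {x : M} (h : C.Algebra x) (hN : C.g x (C.Xp x) (C.Xp x) ≠ 0)
    (v : TangentSpace (𝓡 2) x) : C.Jp x (C.Jp x v) = -((C.cp x * C.cp x) • v) := by
  obtain ⟨e, -, -, e'⟩ := h.relations hN
  rw [e']
  simp only [LinearMap.smul_apply, map_smul, h.Jm_sq, smul_neg, smul_smul]
  congr 2
  linear_combination (C.cp x * C.cp x) * e

/-- On `E₋` this is the statement about `J₋`. On `E₊` one has `J₊² = -c₊²`, and the frame expansion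
together with `g(X₊, X₊) + c₊² = 1` supplies the term `⟨u₊, ·⟩ u₊`. -/
lemma Algebra.isHyperplaneComplex {x : M} (h : C.Algebra x)
    (hN : C.g x (C.Xp x) (C.Xp x) ≠ 0) :
    IsHyperplaneComplex (pairing x) (C.toEnd x) (C.uplus x) where
  skew u u' := by
    obtain ⟨a, b, l, rfl⟩ := exists_minus_add_plus C.g x u
    obtain ⟨a', b', l', rfl⟩ := exists_minus_add_plus C.g x u'
    simp only [map_add, LinearMap.add_apply, toEnd_minus h hN, toEnd_plus h hN,
      pairing_minus_minus, pairing_minus_plus, pairing_plus_minus, pairing_plus_plus,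
      h.Jm_skew a a', h.Jp_skew hN b b', add_apply, smul_apply, map_smul, smul_eq_mul,
      C.g.symm x (C.Xm x) b']
    ring
  sq u := by
    obtain ⟨a, b, l, rfl⟩ := exists_minus_add_plus C.g x u
    simp only [map_add, toEnd_minus h hN, toEnd_plus h hN, h.Jm_sq, Components.uplus,
      pairing_plus_minus, pairing_plus_plus, zero_add, minus_neg, ← plus_smul, neg_add, add_assoc,
      ← plus_neg, ← plus_add]
    congr 1
    rw [plus_inj]
    have hb := h.frame_expand hN b
    have norm := h.norm
    have c2 : C.cp x * C.cp x = 1 - C.g x (C.Xp x) (C.Xp x) := by linarith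
    constructor
    · rw [h.Jp_sq hN, map_smul, h.Jp_Xm, c2]
      -- Multiplying the frame expansion by `g(X₊, X₊) = 1 - c₊²` removes the inverse.
      have hb' : C.g x (C.Xp x) (C.Xp x) • b = C.g x b (C.Xp x) • C.Xp x
          + C.g x b (C.Xm x) • C.Xm x := by
        conv_lhs => rw [hb]
        rw [smul_add, smul_smul, smul_smul, mul_inv_cancel_left₀ hN, mul_inv_cancel_left₀ hN]
      rw [C.g.symm x (C.Xp x) b]
      rw [sub_smul, one_smul, hb']
      module
    · rw [add_apply, h.Jp_skew hN, h.Jp_Xm, map_smul, map_smul, smul_apply, h.norm_Xm,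
        C.g.symm x b]
      simp only [smul_eq_mul]
      linear_combination (-l) * norm

lemma smooth_sharp (hN : ∀ x, C.g x (C.Xp x) (C.Xp x) ≠ 0) {ξ : OneForm M}
    (hξ : SmoothOneForm ξ) : SmoothVField fun x => C.sharp x (ξ x) := by
  have hi := (C.g.smooth_apply C.smooth_Xp C.smooth_Xp).inv hN
  exact (C.smooth_Xp.smul (hi.mul (hξ.apply C.smooth_Xp))).add
    (C.smooth_Xm.smul (hi.mul (hξ.apply C.smooth_Xm)))

lemma smooth_parts (hN : ∀ x, C.g x (C.Xp x) (C.Xp x) ≠ 0) {u : Sec M} (hu : SmoothSec u) :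
    SmoothSec (fun x => minus C.g x (C.Jm x ((1 / 2 : ℝ) • ((u x).1 - C.sharp x (u x).2.1)))) ∧
    SmoothSec (fun x => plus C.g x
      (C.Jp x ((1 / 2 : ℝ) • ((u x).1 + C.sharp x (u x).2.1)) + (u x).2.2 • C.Xm x)
        (-C.g x ((1 / 2 : ℝ) • ((u x).1 + C.sharp x (u x).2.1)) (C.Xm x))) := by
  have hs := smooth_sharp hN hu.2.1
  have hp := (hu.1.add hs).smul (smoothFun_const (1 / 2))
  exact ⟨minus_smooth _ (C.smooth_Jm _ ((hu.1.sub hs).smul (smoothFun_const (1 / 2)))),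
    plus_smooth _ ((C.smooth_Jp _ hp).add (C.smooth_Xm.smul hu.2.2))
      (C.g.smooth_apply hp C.smooth_Xm).neg⟩

lemma smooth_toEnd (hN : ∀ x, C.g x (C.Xp x) (C.Xp x) ≠ 0) {u : Sec M} (hu : SmoothSec u) :
    SmoothSec fun x => C.toEnd x (u x) :=
  (smooth_parts hN hu).1.add (smooth_parts hN hu).2

/-- The endomorphism `𝒢^end 𝓕`. -/
def toEndTwo (C : Components M) : EndField M := fun x => C.g.standard.gend x ∘ₗ C.toEnd x

lemma smooth_toEndTwo (hN : ∀ x, C.g x (C.Xp x) (C.Xp x) ≠ 0) {u : Sec M} (hu : SmoothSec u) :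
    SmoothSec fun x => C.toEndTwo x (u x) := by
  have e : (fun x => C.toEndTwo x (u x)) = fun x =>
      -minus C.g x (C.Jm x ((1 / 2 : ℝ) • ((u x).1 - C.sharp x (u x).2.1))) +
      plus C.g x (C.Jp x ((1 / 2 : ℝ) • ((u x).1 + C.sharp x (u x).2.1)) + (u x).2.2 • C.Xm x)
        (-C.g x ((1 / 2 : ℝ) • ((u x).1 + C.sharp x (u x).2.1)) (C.Xm x)) := by
    funext x
    change C.g.standard.gend x (minus C.g x _ + plus C.g x _ _) = _
    rw [map_add, C.g.isStandard_standard.gend_minus, C.g.isStandard_standard.gend_plus]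
  rw [e]
  exact (smooth_parts hN hu).1.neg.add (smooth_parts hN hu).2

lemma toEndTwo_minus {x : M} (h : C.Algebra x) (hN : C.g x (C.Xp x) (C.Xp x) ≠ 0)
    (v : TangentSpace (𝓡 2) x) : C.toEndTwo x (minus C.g x v) = -minus C.g x (C.Jm x v) := by
  rw [toEndTwo, LinearMap.comp_apply, toEnd_minus h hN, C.g.isStandard_standard.gend_minus]

lemma toEndTwo_plus {x : M} (h : C.Algebra x) (hN : C.g x (C.Xp x) (C.Xp x) ≠ 0)
    (v : TangentSpace (𝓡 2) x) (l : ℝ) : C.toEndTwo x (plus C.g x v l) =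
      C.toEnd x (plus C.g x v l) := by
  rw [toEndTwo, LinearMap.comp_apply, toEnd_plus h hN, C.g.isStandard_standard.gend_plus]

/-- Changing the sign on `E₋` affects neither the square nor skewness, since `E₊` and `E₋` are
invariant and orthogonal. -/
lemma Algebra.isHyperplaneComplex_two {x : M} (h : C.Algebra x)
    (hN : C.g x (C.Xp x) (C.Xp x) ≠ 0) :
    IsHyperplaneComplex (pairing x) (C.toEndTwo x) (C.uplus x) where
  skew u u' := by
    have sk := (h.isHyperplaneComplex hN).skew
    obtain ⟨a, b, l, rfl⟩ := exists_minus_add_plus C.g x u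
    obtain ⟨a', b', l', rfl⟩ := exists_minus_add_plus C.g x u'
    have s1 := sk (minus C.g x a) (minus C.g x a')
    have s2 := sk (plus C.g x b l) (plus C.g x b' l')
    simp only [map_add, LinearMap.add_apply, toEndTwo_minus h hN, toEndTwo_plus h hN, map_neg,
      LinearMap.neg_apply]
    rw [← toEnd_minus h hN, ← toEnd_minus h hN, s1, s2]
    simp only [toEnd_minus h hN, toEnd_plus h hN, pairing_minus_plus, pairing_plus_minus]
    ring
  sq u := by
    have sq := (h.isHyperplaneComplex hN).sq
    obtain ⟨a, b, l, rfl⟩ := exists_minus_add_plus C.g x u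
    have s1 := sq (minus C.g x a + plus C.g x b l)
    rw [← s1]
    simp only [map_add, toEndTwo_minus h hN, toEndTwo_plus h hN, map_neg, toEnd_minus h hN,
      toEnd_plus h hN, neg_neg]

lemma toEnd_uplus {x : M} (h : C.Algebra x) (hN : C.g x (C.Xp x) (C.Xp x) ≠ 0) :
    C.toEnd x (C.uplus x) = 0 := by
  rw [uplus, toEnd_plus h hN, h.orth, h.Jp_Xp]
  simp [plus]

lemma toEndTwo_uplus {x : M} (h : C.Algebra x) (hN : C.g x (C.Xp x) (C.Xp x) ≠ 0) :
    C.toEndTwo x (C.uplus x) = 0 := by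
  rw [uplus, toEndTwo_plus h hN]
  exact toEnd_uplus h hN

lemma Algebra.uplus_norm {x : M} (h : C.Algebra x) : pairing x (C.uplus x) (C.uplus x) = 1 := by
  rw [uplus, pairing_plus_plus, h.norm]

lemma isBGenAlmostComplex (h : ∀ x, C.Algebra x) {A : EndField M}
    (hs : ∀ u, SmoothSec u → SmoothSec fun x => A x (u x))
    (hc : ∀ x, IsHyperplaneComplex (pairing x) (A x) (C.uplus x))
    (hu : ∀ x, A x (C.uplus x) = 0) : IsBGenAlmostComplex A where
  smooth := hs
  isotropic x := (hc x).isotropic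
  rank x := (hc x).rank (h x).uplus_norm (finrank_fiber x)
  ker x := (hc x).eq_zero_of_orthogonal (pairing_symm x) (h x).uplus_norm
    (pairing_nondegenerate C.g x) (hu x)

/-- The section `u₊` is parallel along `E₋`. -/
def Equations (C : Components M) (F : TwoForm M) : Prop :=
  ∀ Y Z : VField M, SmoothVField Y → SmoothVField Z → ∀ x,
    leviCivita C.g Y C.Xp Z x = C.cp x * F x (Y x) (Z x) ∧
      dir Y C.cp x = -F x (Y x) (C.Xp x)

/-- For `w ⊥ u₊` the derivative is moved onto `u₊`: `⟨[v, w], u₊⟩ = -⟨[v, u₊], w⟩`, which the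
equations annihilate. -/
lemma Equations.bracketPairing_eq_zero {F : TwoForm M} (hE : C.Equations F) {Y W : VField M}
    {l : M → ℝ} (hY : SmoothVField Y) (hW : SmoothVField W) (hl : SmoothFun l)
    (h : ∀ x, C.g x (W x) (C.Xp x) + l x * C.cp x = 0) (x : M) :
    bracketPairing F (fun x => minus C.g x (Y x)) (fun x => plus C.g x (W x) (l x)) C.uplus x
      = 0 := by
  rw [bracketPairing_compat_of_orthogonal F (minus_smooth _ hY) (plus_smooth _ hW hl)
    C.smooth_uplus (fun x => by rw [uplus, pairing_plus_plus, h]), neg_eq_zero]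
  refine (bracketPairing_plus_minus F C.g hW C.smooth_Xp hY hl C.smooth_cp x).trans ?_
  rw [(hE Y W hY hW x).1, (hE Y W hY hW x).2]
  ring

/-- The frame comes from `m = X₊ - i_{X₊}g` in `E₋` and `n = X₋ + i_{X₋}g` in `E₊`. As `A` preserves
`E₋` and `E₊`, all four brackets needed pair a section of `E₋` with one of `E₊` orthogonal to `u₊`.
The free sign `τ` covers both `𝓕` and `𝒢^end 𝓕`. -/
lemma Equations.isIntegrable {F : TwoForm M} (hE : C.Equations F) (h : ∀ x, C.Algebra x)
    (hN : ∀ x, C.g x (C.Xp x) (C.Xp x) ≠ 0) {A : EndField M}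
    (hs : ∀ u, SmoothSec u → SmoothSec fun x => A x (u x))
    (hc : ∀ x, IsHyperplaneComplex (pairing x) (A x) (C.uplus x))
    (hu : ∀ x, A x (C.uplus x) = 0) {τ : M → ℝ} (hτ : SmoothFun τ) (hτ2 : ∀ x, τ x ^ 2 = 1)
    (hm : ∀ x, A x (minus C.g x (C.Xp x)) = minus C.g x (τ x • C.Xm x))
    (hn : ∀ x, A x (plus C.g x (C.Xm x) 0) =
      plus C.g x (C.cp x • C.Xp x) (-C.g x (C.Xp x) (C.Xp x))) : IsIntegrable F A := by
  have o1 : ∀ x, C.g x (C.Xm x) (C.Xp x) + 0 * C.cp x = 0 := fun x => by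
    rw [C.g.symm, (h x).orth]; ring
  have o2 : ∀ x, C.g x (C.cp x • C.Xp x) (C.Xp x)
      + (-C.g x (C.Xp x) (C.Xp x)) * C.cp x = 0 := fun x => by
    rw [map_smul, smul_apply, smul_eq_mul]; ring
  have sN := (C.g.smooth_apply C.smooth_Xp C.smooth_Xp).neg
  have s1 := C.smooth_Xm.smul hτ
  have s2 := C.smooth_Xp.smul C.smooth_cp
  refine isIntegrable_of_frame (u := C.uplus) hs C.smooth_uplus hc (fun x => (h x).uplus_norm) hu
    (fun x => pairing_nondegenerate C.g x) (minus_smooth C.g C.smooth_Xp)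
    (plus_smooth C.g C.smooth_Xm (smoothFun_const 0)) (fun x => ?_) (fun x => ?_)
    (fun x w hw => ?_) (fun x => ?_)
  · rw [(hc x).mem_sqNegOne_iff (h x).uplus_norm, uplus, pairing_plus_minus]
  · rw [(hc x).mem_sqNegOne_iff (h x).uplus_norm, uplus, pairing_plus_plus, (h x).orth]
    ring
  · rw [(hc x).mem_sqNegOne_iff (h x).uplus_norm] at hw
    obtain ⟨a, b, l, rfl⟩ := exists_minus_add_plus C.g x w
    rw [map_add, uplus, pairing_plus_minus, pairing_plus_plus, zero_add, C.g.symm] at hw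
    rw [hm, hn]
    have ea := (h x).frame_expand (hN x) a
    have eb := (h x).frame_expand (hN x) b
    have hNx := hN x
    have t2 := hτ2 x
    set N := C.g x (C.Xp x) (C.Xp x)
    -- The first two coefficients expand the `E₋` part, with `τ = τ⁻¹`; the last is read off from
    -- the scalar part `-N` of `A n`.
    refine ⟨N⁻¹ * C.g x a (C.Xp x), τ x * (N⁻¹ * C.g x a (C.Xm x)), N⁻¹ * C.g x b (C.Xm x),
      -(N⁻¹ * l), ?_⟩
    rw [← minus_smul, ← minus_smul, ← plus_smul, ← plus_smul, ← minus_add, add_assoc, ← plus_add]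
    congr 1
    · rw [minus_inj, smul_smul,
        show τ x * (N⁻¹ * C.g x a (C.Xm x)) * τ x = N⁻¹ * C.g x a (C.Xm x) by
          linear_combination (N⁻¹ * C.g x a (C.Xm x)) * t2]
      exact ea
    · rw [plus_inj, smul_smul]
      constructor
      · rw [show -(N⁻¹ * l) * C.cp x = N⁻¹ * C.g x b (C.Xp x) by
          linear_combination (-N⁻¹) * hw, add_comm]
        exact eb
      · field_simp
        ring
  · simp only [hm, hn]
    exact ⟨hE.bracketPairing_eq_zero C.smooth_Xp C.smooth_Xm (smoothFun_const 0) o1 x,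
      hE.bracketPairing_eq_zero C.smooth_Xp s2 sN o2 x,
      hE.bracketPairing_eq_zero s1 C.smooth_Xm (smoothFun_const 0) o1 x,
      hE.bracketPairing_eq_zero s1 s2 sN o2 x⟩

theorem Equations.isPseudoKahler {F : TwoForm M} (hE : C.Equations F) (h : ∀ x, C.Algebra x)
    (hN : ∀ x, C.g x (C.Xp x) (C.Xp x) ≠ 0) : IsPseudoKahler F C.g.standard C.toEnd := by
  have hst := C.g.isStandard_standard
  have hc := fun x => (h x).isHyperplaneComplex (hN x)
  have hc2 := fun x => (h x).isHyperplaneComplex_two (hN x)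
  have hu := fun x => toEnd_uplus (h x) (hN x)
  have hu2 := fun x => toEndTwo_uplus (h x) (hN x)
  have rel := fun x => (h x).relations (hN x)
  have hn : ∀ x, C.toEnd x (plus C.g x (C.Xm x) 0) =
      plus C.g x (C.cp x • C.Xp x) (-C.g x (C.Xp x) (C.Xp x)) := fun x => by
    rw [toEnd_plus (h x) (hN x), (h x).Jp_Xm, (h x).norm_Xm, zero_smul, add_zero]
  refine ⟨⟨isBGenAlmostComplex h (fun u => smooth_toEnd hN) hc hu, fun x => ?_⟩, ?_,
    isBGenAlmostComplex h (fun u => smooth_toEndTwo hN) hc2 hu2, ?_⟩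
  · refine LinearMap.ext fun u => ?_
    obtain ⟨a, b, l, rfl⟩ := exists_minus_add_plus C.g x u
    simp only [LinearMap.comp_apply, map_add, hst.gend_minus, hst.gend_plus, map_neg,
      toEnd_minus (h x) (hN x), toEnd_plus (h x) (hN x)]
  · refine hE.isIntegrable h hN (fun u => smooth_toEnd hN) hc hu (C.smooth_sign hN).neg
      (fun x => by rw [neg_sq]; exact (rel x).1) (fun x => ?_) hn
    rw [toEnd_minus (h x) (hN x), (rel x).2.1, neg_smul]
  · refine hE.isIntegrable h hN (fun u => smooth_toEndTwo hN) hc2 hu2 (C.smooth_sign hN)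
      (fun x => (rel x).1) (fun x => ?_) (fun x => ?_)
    · change C.toEndTwo x _ = _
      rw [toEndTwo_minus (h x) (hN x), (rel x).2.1, minus_neg, neg_neg]
    · change C.toEndTwo x _ = _
      rw [toEndTwo_plus (h x) (hN x), hn]

theorem hasComponents (h : ∀ x, C.Algebra x)
    (hN : ∀ x, C.g x (C.Xp x) (C.Xp x) ≠ 0) : HasComponents C.g.standard C.toEnd C where
  standard := C.g.isStandard_standard
  eq_Jm x v := congrArg Prod.fst (toEnd_minus (h x) (hN x) v)
  eq_Jp x v := by
    refine (congrArg Prod.fst (toEnd_plus (h x) (hN x) v 0)).trans ?_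
    simp [plus]
  eq_Xm x := by
    have e : plus C.g x 0 1 = (0, 0, 1) := by simp [plus]
    rw [← e, toEnd_plus (h x) (hN x)]
    simp [plus]
  uplus_ker x := toEnd_uplus (h x) (hN x)
  uplus_norm x := (h x).uplus_norm

end Components

/-- A pseudo-Hermitian structure is determined by its components. -/
theorem HasComponents.unique {G G' : GenMetric M} {A A' : EndField M} {C : Components M}
    (hA : IsAlmostPseudoHermitian G A) (hA' : IsAlmostPseudoHermitian G' A')
    (hC : HasComponents G A C) (hC' : HasComponents G' A' C) : G = G' ∧ A = A' := by
  constructor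
  · ext1
    funext x
    ext u
    rw [hC.standard, hC'.standard]
  · funext x
    refine LinearMap.ext fun u => ?_
    obtain ⟨a, b, l, rfl⟩ := exists_minus_add_plus C.g x u
    rw [map_add, map_add, hC.apply_minus hA, hC'.apply_minus hA', hC.apply_plus hA,
      hC'.apply_plus hA']

end Sufficiency

end BGen

end

noncomputable section

namespace BGen

/-! ### Existence and uniqueness from `(g, X₊, X₋, ε₀, ε₊)` -/

section Construction

variable {M : Type*} [TopologicalSpace M] [ChartedSpace (EuclideanSpace ℝ (Fin 2)) M]
  [IsManifold (𝓡 2) ∞ M]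

/-- The rotation with `X₊ ↦ -ε X₋`, `X₋ ↦ ε X₊`. -/
def rotation (g : PseudoMetric M) (Xp Xm : VField M) (ε : ℝ) (x : M) :
    TangentSpace (𝓡 2) x →ₗ[ℝ] TangentSpace (𝓡 2) x where
  toFun v := (ε * (g x (Xp x) (Xp x))⁻¹ * g x v (Xm x)) • Xp x
    - (ε * (g x (Xp x) (Xp x))⁻¹ * g x v (Xp x)) • Xm x
  map_add' v w := by simp only [map_add, add_apply]; module
  map_smul' r v := by simp only [map_smul, smul_apply, smul_eq_mul, RingHom.id_apply]; module

variable {g : PseudoMetric M} {Xp Xm : VField M} {ε : ℝ}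

lemma smooth_rotation (hXp : SmoothVField Xp) (hXm : SmoothVField Xm)
    (hN : ∀ x, g x (Xp x) (Xp x) ≠ 0) {X : VField M} (hX : SmoothVField X) :
    SmoothVField fun x => rotation g Xp Xm ε x (X x) := by
  have hi := (smoothFun_const ε).mul ((g.smooth_apply hXp hXp).inv hN)
  exact (hXp.smul (hi.mul (g.smooth_apply hX hXm))).sub
    (hXm.smul (hi.mul (g.smooth_apply hX hXp)))

/-- The components determined by `(g, X₊, X₋, ε₀, c₊)`. -/
def componentsOf (g : PseudoMetric M) (Xp Xm : VField M) (ε : ℝ) (c : M → ℝ)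
    (hXp : SmoothVField Xp) (hXm : SmoothVField Xm) (hc : SmoothFun c)
    (hN : ∀ x, g x (Xp x) (Xp x) ≠ 0) : Components M where
  g := g
  Jp x := (ε * c x) • rotation g Xp Xm ε x
  Jm := rotation g Xp Xm ε
  Xp := Xp
  Xm := Xm
  cp := c
  smooth_Jp _ hX := (smooth_rotation hXp hXm hN hX).smul ((smoothFun_const ε).mul hc)
  smooth_Jm _ hX := smooth_rotation hXp hXm hN hX
  smooth_Xp := hXp
  smooth_Xm := hXm
  smooth_cp := hc

variable {c : M → ℝ} (hXp : SmoothVField Xp) (hXm : SmoothVField Xm) (hc : SmoothFun c)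
  (hN : ∀ x, g x (Xp x) (Xp x) ≠ 0)

lemma componentsOf_relations (orth : ∀ x, g x (Xp x) (Xm x) = 0)
    (norm : ∀ x, g x (Xm x) (Xm x) = g x (Xp x) (Xp x)) :
    (componentsOf g Xp Xm ε c hXp hXm hc hN).Relations ε := by
  intro x
  have hNx := hN x
  have orth' : g x (Xm x) (Xp x) = 0 := by rw [g.symm, orth]
  refine ⟨?_, ?_, rfl⟩
  · change (ε * (g x (Xp x) (Xp x))⁻¹ * g x (Xp x) (Xm x)) • Xp x
      - (ε * (g x (Xp x) (Xp x))⁻¹ * g x (Xp x) (Xp x)) • Xm x = -(ε • Xm x)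
    rw [orth, inv_mul_cancel_right₀ hNx]
    simp
  · change (ε * (g x (Xp x) (Xp x))⁻¹ * g x (Xm x) (Xm x)) • Xp x
      - (ε * (g x (Xp x) (Xp x))⁻¹ * g x (Xm x) (Xp x)) • Xm x = ε • Xp x
    rw [orth', norm, inv_mul_cancel_right₀ hNx]
    simp

lemma componentsOf_algebra (hε : ε = 1 ∨ ε = -1) (orth : ∀ x, g x (Xp x) (Xm x) = 0)
    (norm : ∀ x, g x (Xm x) (Xm x) = g x (Xp x) (Xp x))
    (hcN : ∀ x, g x (Xp x) (Xp x) + c x * c x = 1) (x : M) :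
    (componentsOf g Xp Xm ε c hXp hXm hc hN).Algebra x := by
  have hNx := hN x
  have hε2 : ε * ε = 1 := by rcases hε with rfl | rfl <;> norm_num
  obtain ⟨r1, r2, r3⟩ := componentsOf_relations (ε := ε) hXp hXm hc hN orth norm x
  set C := componentsOf g Xp Xm ε c hXp hXm hc hN
  refine ⟨hcN x, norm x, orth x, fun v => ?_, fun v w => ?_, ?_, ?_⟩
  · have ev := g.frame_expand x hNx rfl (norm x) (orth x) v
    rw [ev, map_add, map_smul, map_smul]
    have s1 : C.Jm x (C.Jm x (C.Xp x)) = -C.Xp x := by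
      rw [r1, map_neg, map_smul, r2, smul_smul, hε2, one_smul]
    have s2 : C.Jm x (C.Jm x (C.Xm x)) = -C.Xm x := by
      rw [r2, map_smul, r1, smul_neg, smul_smul, hε2, one_smul]
    change C.Jm x (_ • C.Jm x (C.Xp x) + _ • C.Jm x (C.Xm x)) = _
    rw [map_add, map_smul, map_smul, s1, s2, smul_neg, smul_neg, neg_add]
    rfl
  · change g x ((ε * (g x (Xp x) (Xp x))⁻¹ * g x v (Xm x)) • Xp x
      - (ε * (g x (Xp x) (Xp x))⁻¹ * g x v (Xp x)) • Xm x) w =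
      -g x v ((ε * (g x (Xp x) (Xp x))⁻¹ * g x w (Xm x)) • Xp x
      - (ε * (g x (Xp x) (Xp x))⁻¹ * g x w (Xp x)) • Xm x)
    simp only [map_sub, map_smul, sub_apply, smul_apply, smul_eq_mul, g.symm x w]
    ring
  · rw [r3, LinearMap.smul_apply, r1, smul_neg, smul_smul,
      show ε * C.cp x * ε = C.cp x by linear_combination C.cp x * hε2]
  · rw [r3, LinearMap.smul_apply, r2, smul_smul,
      show ε * C.cp x * ε = C.cp x by linear_combination C.cp x * hε2]

/-- For a Killing field `∇X₊` is skew, hence equals half of `dX₊^♭`, that is `c₊F`. -/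
lemma equations_of_killing {C : Components M} {F : TwoForm M} (h : ∀ x, C.Algebra x)
    (hK : IsKilling C.g C.Xp) (hc : ∀ x, C.cp x ≠ 0) (hF : IsHalfD F C.cp C.g C.Xp) :
    C.Equations F := by
  have lc : ∀ Y Z : VField M, SmoothVField Y → SmoothVField Z → ∀ x,
      leviCivita C.g Y C.Xp Z x = C.cp x * F x (Y x) (Z x) := by
    intro Y Z hY hZ x
    have h1 := leviCivita_symm_eq C.g C.Xp Y Z x
    rw [hK Y Z hY hZ x, sub_self] at h1
    have h2 := leviCivita_skew_eq C.g C.Xp Y Z x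
    rw [hF Y Z hY hZ x, ← h2]
    have := hc x
    field_simp
    linarith
  refine fun Y Z hY hZ x => ⟨lc Y Z hY hZ x, ?_⟩
  -- Differentiating `g(X₊, X₊) + c₊² = 1` gives `2c₊F(Y, X₊) + 2c₊ dc₊(Y) = 0`, and `c₊` can be
  -- cancelled.
  have h1 := leviCivita_compat C.g Y C.Xp C.Xp x
  rw [lc Y _ hY C.smooth_Xp] at h1
  have h2 : dir Y (fun y => C.g y (C.Xp y) (C.Xp y) + C.cp y * C.cp y) x = 0 := by
    rw [show (fun y => C.g y (C.Xp y) (C.Xp y) + C.cp y * C.cp y) = fun _ => 1 from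
      funext fun y => (h y).norm, dir_const]
  rw [dir_add _ ((C.g.smooth_apply C.smooth_Xp C.smooth_Xp).diff x)
    ((C.smooth_cp.mul C.smooth_cp).diff x),
    dir_mul _ (C.smooth_cp.diff x) (C.smooth_cp.diff x), ← h1] at h2
  refine mul_left_cancel₀ (hc x) ?_
  linarith

lemma equations_of_parallel {C : Components M} {F : TwoForm M} (hP : IsParallel C.g C.Xp)
    (hc : ∀ x, C.cp x = 0) (hF : ∀ x, F x = 0) : C.Equations F := by
  refine fun Y Z hY hZ x => ⟨?_, ?_⟩
  · rw [hP Y Z hY hZ x, hc]; ring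
  · rw [show C.cp = fun _ => 0 from funext hc, dir_const, hF x]
    simp

lemma smoothFun_sqrt {f : M → ℝ} (hf : SmoothFun f) (h : ∀ x, 0 < f x) :
    SmoothFun fun x => √(f x) := fun x =>
  ((Real.contDiffAt_sqrt (h x).ne').contMDiffAt).comp x (hf x)

theorem exists_pseudoKahler (F : TwoForm M) (g : PseudoMetric M) (Xp Xm : VField M) (ε₀ εp : ℝ)
    (hXp : SmoothVField Xp) (hXm : SmoothVField Xm) (hε₀ : ε₀ = 1 ∨ ε₀ = -1)
    (hεp : εp = 1 ∨ εp = -1) (hN : ∀ p, g p (Xp p) (Xp p) ≠ 0)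
    (orth : ∀ p, g p (Xp p) (Xm p) = 0) (norm : ∀ p, g p (Xm p) (Xm p) = g p (Xp p) (Xp p))
    (H : (IsKilling g Xp ∧ (∀ p, g p (Xp p) (Xp p) < 1) ∧
          IsHalfD F (fun p => εp * √(1 - g p (Xp p) (Xp p))) g Xp) ∨
        (IsParallel g Xp ∧ (∀ p, g p (Xp p) (Xp p) = 1) ∧ ∀ p, F p = 0)) :
    ∃ C : Components M,
      C.g = g ∧ C.Xp = Xp ∧ C.Xm = Xm ∧
      (∀ p, C.cp p = εp * √(1 - g p (Xp p) (Xp p))) ∧ C.Relations ε₀ ∧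
      ∃! P : GenMetric M × EndField M,
        IsPseudoKahler F P.1 P.2 ∧ HasComponents P.1 P.2 C := by
  have hεp0 : εp ≠ 0 := by rcases hεp with rfl | rfl <;> norm_num
  have hεp2 : εp * εp = 1 := by rcases hεp with rfl | rfl <;> norm_num
  have le : ∀ p, 0 ≤ 1 - g p (Xp p) (Xp p) := fun p => by
    rcases H with ⟨-, h, -⟩ | ⟨-, h, -⟩ <;> linarith [h p]
  -- The square root is smooth away from zero; in the parallel case its argument is identically
  -- zero, so `c₊` is constant.
  have sc : SmoothFun fun p => εp * √(1 - g p (Xp p) (Xp p)) := by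
    rcases H with ⟨-, h, -⟩ | ⟨-, h, -⟩
    · exact (smoothFun_const εp).mul (smoothFun_sqrt
        ((smoothFun_const 1).sub (g.smooth_apply hXp hXp)) fun p => by linarith [h p])
    · have e : (fun p => εp * √(1 - g p (Xp p) (Xp p))) = fun _ => 0 :=
        funext fun p => by rw [h p]; simp
      rw [e]
      exact smoothFun_const 0
  set C := componentsOf g Xp Xm ε₀ _ hXp hXm sc hN with hC
  have alg : ∀ x, C.Algebra x := componentsOf_algebra hXp hXm sc hN hε₀ orth norm fun x => by
    rw [mul_mul_mul_comm, hεp2, Real.mul_self_sqrt (le x)]; ring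
  have hE : C.Equations F := by
    rcases H with ⟨h1, h2, h3⟩ | ⟨h1, h2, h3⟩
    · exact equations_of_killing alg h1
        (fun x => mul_ne_zero hεp0 (Real.sqrt_ne_zero'.2 (by linarith [h2 x]))) h3
    · refine equations_of_parallel h1 (fun x => ?_) h3
      change εp * √(1 - g x (Xp x) (Xp x)) = 0
      rw [h2 x]; simp
  have hK := hE.isPseudoKahler alg hN
  have hH := C.hasComponents alg hN
  refine ⟨C, rfl, rfl, rfl, fun p => rfl, componentsOf_relations hXp hXm sc hN orth norm,
    ⟨(C.g.standard, C.toEnd), ⟨hK, hH⟩, ?_⟩⟩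
  rintro ⟨G', A'⟩ ⟨hK', hH'⟩
  obtain ⟨e1, e2⟩ := hH'.unique hK'.almostHermitian hK.almostHermitian hH
  exact Prod.ext e1 e2

end Construction

/-! ### Left-invariant structures -/

section LieGroups

variable {M : Type*} [TopologicalSpace M] [ChartedSpace (EuclideanSpace ℝ (Fin 2)) M]
  [IsManifold (𝓡 2) ∞ M] {F : TwoForm M} {G : GenMetric M} {A : EndField M} {C : Components M}

/-- If `c₊` is constant, the frame `(X₊, X₋)` is parallel and hence commutes. -/
lemma IsPseudoKahler.bracket_frame (hK : IsPseudoKahler F G A) (hC : HasComponents G A C)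
    (hN : C.NonNull) {r : ℝ} (h : ∀ x, C.cp x = r) (x : M) :
    mlieBracket (𝓡 2) C.Xp C.Xm x = 0 := by
  have alg := hC.algebra hK.almostHermitian
  have par := hK.isParallel hC (hK.form_eq_zero hC hN h)
  -- The norm of `X₋` is the constant `1 - r²`, so `∇X₋ ⊥ X₋`.
  have m1 : ∀ Y, leviCivita C.g Y C.Xm C.Xm x = 0 := fun Y => by
    have := leviCivita_compat C.g Y C.Xm C.Xm x
    rw [show (fun y => C.g y (C.Xm y) (C.Xm y)) = fun _ => 1 - r * r from
      funext fun y => by rw [(alg y).norm_Xm]; linarith [h y ▸ (alg y).norm], dir_const] at this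
    linarith
  -- Differentiating `g(X₊, X₋) = 0` with `X₊` parallel gives `∇X₋ ⊥ X₊`.
  have m2 : ∀ Y, SmoothVField Y → leviCivita C.g Y C.Xm C.Xp x = 0 := fun Y hY => by
    have := leviCivita_compat C.g Y C.Xp C.Xm x
    rw [show (fun y => C.g y (C.Xp y) (C.Xm y)) = fun _ => 0 from
      funext fun y => (alg y).orth, dir_const, par Y _ hY C.smooth_Xm x] at this
    linarith
  -- Vanishing torsion shows that `[X₊, X₋]` is orthogonal to both frame vectors.
  have t1 := leviCivita_torsion C.g C.Xp C.Xm C.Xp x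
  have t2 := leviCivita_torsion C.g C.Xp C.Xm C.Xm x
  rw [m2 _ C.smooth_Xp, par _ _ C.smooth_Xm C.smooth_Xp, sub_self] at t1
  rw [m1, par _ _ C.smooth_Xm C.smooth_Xm, sub_self] at t2
  rw [(alg x).frame_expand (hN x).1 (mlieBracket (𝓡 2) C.Xp C.Xm x), ← t1, ← t2]
  simp

/-- Invariance makes `c₊` constant, so `F = 0` and the invariant frame `(X₊, X₋)` commutes; every
invariant field is a constant-coefficient combination of it. -/
theorem lieGroup_abelian {G : Type*} [TopologicalSpace G]
    [ChartedSpace (EuclideanSpace ℝ (Fin 2)) G] [Group G] [LieGroup (𝓡 2) ∞ G]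
    {F : TwoForm G} {𝒢 : GenMetric G} {𝓕 : EndField G} {C : Components G}
    (hK : IsPseudoKahler F 𝒢 𝓕) (hC : HasComponents 𝒢 𝓕 C) (hN : C.NonNull)
    (hL : C.LeftInvariant) :
    (∀ v w : GroupLieAlgebra (𝓡 2) G, ⁅v, w⁆ = 0) ∧ ∀ p, F p = 0 := by
  have hc : ∀ x, C.cp x = C.cp 1 := fun x => by
    have := hL.cp x 1
    rwa [mul_one] at this
  refine ⟨fun v w => ?_, hK.form_eq_zero hC hN hc⟩
  have inv : ∀ X : VField G, (∀ a x, X (a * x) = dLeft a x (X x)) →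
      mulInvariantVectorField (I := 𝓡 2) (X 1) = X := fun X hX => by
    funext a
    -- The two values lie in different tangent fibres, so they are compared in the model space.
    have h1 : (X (a * 1) : EuclideanSpace ℝ (Fin 2)) = X a := by
      rw [mul_one]
    exact (hX a 1).symm.trans h1
  have ex : ∀ v : GroupLieAlgebra (𝓡 2) G, ∃ a b : ℝ,
      mulInvariantVectorField v = fun x => a • C.Xp x + b • C.Xm x := fun v => by
    refine ⟨(C.g 1 (C.Xp 1) (C.Xp 1))⁻¹ * C.g 1 v (C.Xp 1),
      (C.g 1 (C.Xp 1) (C.Xp 1))⁻¹ * C.g 1 v (C.Xm 1), ?_⟩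
    conv_lhs => rw [(hC.algebra hK.almostHermitian 1).frame_expand (hN 1).1 v]
    rw [mulInvariantVectorField_add, mulInvariantVectorField_smul, mulInvariantVectorField_smul,
      inv _ hL.Xp, inv _ hL.Xm]
    rfl
  have lin : ∀ (V : VField G) (a b : ℝ), mlieBracket (𝓡 2) V
      (fun x => a • C.Xp x + b • C.Xm x) 1 =
      a • mlieBracket (𝓡 2) V C.Xp 1 + b • mlieBracket (𝓡 2) V C.Xm 1 := fun V a b => by
    rw [bracket_add_right _ ((C.smooth_Xp.smul (smoothFun_const a)).diff 1)
      ((C.smooth_Xm.smul (smoothFun_const b)).diff 1),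
      bracket_smul_right _ ((smoothFun_const a).diff 1) (C.smooth_Xp.diff 1),
      bracket_smul_right _ ((smoothFun_const b).diff 1) (C.smooth_Xm.diff 1), dir_const, dir_const]
    simp
  have b0 := hK.bracket_frame hC hN hc 1
  obtain ⟨a, b, hv⟩ := ex v
  obtain ⟨a', b', hw⟩ := ex w
  rw [GroupLieAlgebra.bracket_def, hv, hw, lin, bracket_swap _ C.Xp, bracket_swap _ C.Xm, lin, lin,
    bracket_swap C.Xm C.Xp, b0, mlieBracket_self, mlieBracket_self]
  simp

end LieGroups

end BGen

end

theorem mainTheorem8 :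
    -- manifolds
    (∀ (M : Type*) [TopologicalSpace M] [ChartedSpace (EuclideanSpace ℝ (Fin 2)) M]
      [IsManifold (𝓡 2) ∞ M] [T2Space M] [SigmaCompactSpace M] (F : BGen.TwoForm M),
      -- i)
      (∀ (𝒢 : BGen.GenMetric M) (𝓕 : BGen.EndField M) (C : BGen.Components M),
        BGen.IsPseudoKahler F 𝒢 𝓕 → BGen.HasComponents 𝒢 𝓕 C → C.NonNull →
          (PreconnectedSpace M → ∃ ε₀ : ℝ, (ε₀ = 1 ∨ ε₀ = -1) ∧ C.Relations ε₀) ∧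
          ((∀ p, C.cp p ≠ 0) →
            BGen.IsKilling C.g C.Xp ∧ (∀ p, C.g p (C.Xp p) (C.Xp p) < 1) ∧
              BGen.IsHalfD F C.cp C.g C.Xp) ∧
          ((∀ p, C.cp p = 0) →
            BGen.IsParallel C.g C.Xp ∧ (∀ p, C.g p (C.Xp p) (C.Xp p) = 1) ∧
              ∀ p, F p = 0)) ∧
      -- ii)
      (∀ (g : BGen.PseudoMetric M) (Xp Xm : BGen.VField M) (ε₀ εp : ℝ),
        BGen.SmoothVField Xp → BGen.SmoothVField Xm →
        (ε₀ = 1 ∨ ε₀ = -1) → (εp = 1 ∨ εp = -1) →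
        (∀ p, g p (Xp p) (Xp p) ≠ 0) → (∀ p, g p (Xp p) (Xm p) = 0) →
        (∀ p, g p (Xm p) (Xm p) = g p (Xp p) (Xp p)) →
        ((BGen.IsKilling g Xp ∧ (∀ p, g p (Xp p) (Xp p) < 1) ∧
            BGen.IsHalfD F (fun p => εp * √(1 - g p (Xp p) (Xp p))) g Xp) ∨
          (BGen.IsParallel g Xp ∧ (∀ p, g p (Xp p) (Xp p) = 1) ∧ ∀ p, F p = 0)) →
        ∃ C : BGen.Components M,
          C.g = g ∧ C.Xp = Xp ∧ C.Xm = Xm ∧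
          (∀ p, C.cp p = εp * √(1 - g p (Xp p) (Xp p))) ∧ C.Relations ε₀ ∧
          ∃! P : BGen.GenMetric M × BGen.EndField M,
            BGen.IsPseudoKahler F P.1 P.2 ∧ BGen.HasComponents P.1 P.2 C)) ∧
    -- Lie groups
    (∀ (G : Type*) [TopologicalSpace G] [ChartedSpace (EuclideanSpace ℝ (Fin 2)) G] [Group G]
      [LieGroup (𝓡 2) ∞ G] [T2Space G] [SigmaCompactSpace G] (F : BGen.TwoForm G)
      (𝒢 : BGen.GenMetric G) (𝓕 : BGen.EndField G) (C : BGen.Components G),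
      BGen.IsPseudoKahler F 𝒢 𝓕 → BGen.HasComponents 𝒢 𝓕 C → C.NonNull →
      F.LeftInvariant → C.LeftInvariant →
        (∀ v w : GroupLieAlgebra (𝓡 2) G, ⁅v, w⁆ = 0) ∧ ∀ p, F p = 0) := by
  refine ⟨?_, ?_⟩
  · intro M _ _ _ _ _ F
    refine ⟨fun 𝒢 𝓕 C hK hC hN => ?_, BGen.exists_pseudoKahler F⟩
    have alg := hC.algebra hK.almostHermitian
    refine ⟨fun _ => C.exists_relations alg fun x => (hN x).1, fun h0 => ?_, fun h0 => ?_⟩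
    · refine ⟨hK.isKilling hC, fun p => ?_, hK.isHalfD hC h0⟩
      have := mul_self_pos.2 (h0 p)
      linarith [(alg p).norm]
    · have hF := hK.form_eq_zero hC hN h0
      refine ⟨hK.isParallel hC hF, fun p => ?_, hF⟩
      have := (alg p).norm
      rw [h0 p] at this
      linarith
  · intro G _ _ _ _ _ _ F 𝒢 𝓕 C hK hC hN _ hL
    exact BGen.lieGroup_abelian hK hC hN hL
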